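/- **Setting.** The Bloch vector $v=(x,y,z)$ of an open qubit obeys $\dot v=A_uv+b$ with $b=(0,0,\gamma_1)^\top$ and $$A_u=\begin{pmatrix}-\frac{\gamma_1}{2}-2\gamma_2&-\omega&0\\ \omega&-\frac{\gamma_1}{2}-2\gamma_2&-\kappa u\\ 0&\kappa u&-\gamma_1\end{pmatrix}.$$ Let $\phi_\theta(v_0;u,t)=e^{tA_u}v_0+\int_0^te^{(t-s)A_u}b\,ds$ be its flow under constant control $u$, let $h(v)=\frac{1-z}{2}$ be the probability of the excited outcome, and let $v_1=(0,0,-1)$. The unknown parameter $\theta=(\gamma_1,\kappa,\gamma_2,\omega)$ lies in a known open box $\Theta=(\underline\gamma_1,\overline\gamma_1)\times(\underline\kappa,\overline\kappa)\times(\underline\gamma_2,\overline\gamma_2)\times(\underline\omega,\overline\omega)$ (nonempty intervals) whose closure is a compact subset of $(0,\infty)^4$. Fix $\beta\in(0,1)$, let $t_1>0$ solve $e^{\overline\gamma_1t_1}(2-\overline\gamma_1t_1)=2$, and put $\tau_2=(1-\beta)\pi/\overline\kappa$, $t_3=\pi/(\underline\omega+\overline\omega)$. For $u>0$ and $\varepsilon=1/u$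 put $P^\pm=\phi_\theta(\cdot\,;\pm u,\varepsilon\tau_2)$, $R_t=\phi_\theta(\cdot\,;0,t)$ and $$F_\varepsilon(\theta)=\big(h(R_{t_1}v_1),\;h(P^+v_1),\;h(P^-R_{t_3}P^+v_1),\;h(P^-R_{2t_3}P^+v_1)\big).$$ $F_0$ is defined by the same formula with $P^\pm$ replaced by the rotations of angle $\pm\kappa\tau_2$ about the $x$-axis. For each of the four experiments one performs $n$ measurements with pulse amplitude $u=u_{\max}$. All outcomes are independent, and those of experiment $j$ are Bernoulli with parameter $p_j=F_{1/u}(\theta)_j$. Let $\hat p$ be the vector of empirical frequencies and $\hat\theta=F_0^{-1}(\hat p)$, where $F_0^{-1}$ is the inverse of $F_0:\Theta\to F_0(\Theta)$, extended arbitrarily outside $F_0(\Theta)$. Put $\mu=\mu_u=F_0^{-1}(F_{1/u}(\theta))$, $$\Sigma(p)=\mathrm{Jac}F_0^{-1}(p)\,\mathrm{diag}(p)(\mathrm{id}-\mathrm{diag}(p))\,\mathrm{Jac}F_0^{-1}(p)^\top,\qquad \hat{\mathcal E}_\alpha=\{e\in\mathbb R^4:\ e^\top\Sigma(\hat p)^{-1}e\le\chi^2_{4,1-\alpha}\},$$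 where $\chi^2_{4,1-\alpha}$ is the $(1-\alpha)$-quantile of the $\chi^2$ distribution with 4 degrees of freedom. Let $\Delta=\prod_{i=1}^4[-\Delta_i,\Delta_i]$ with $$\Delta_i=\sup_{\theta\in\Theta}\ \sup_{\delta\in\Delta'(\theta)}\big(\mathrm{Jac}F_0(\theta)^{-1}\delta\big)_i,$$ $$\Delta'(\theta)=\{0\}\times[-C,C]\times[-C'(t_3),C'(t_3)]\times[-C'(2t_3),C'(2t_3)],$$ $$C=\tfrac{\tau_2}{2}(m+\gamma_1),\qquad C'(t)=C+\tfrac{\tau_2}{2}\big(m(2e^{-\lambda t}-e^{-\gamma_1t})+\gamma_1e^{-\lambda t}\big),$$ $$\lambda=\min\big(\gamma_1,\tfrac12(\gamma_1+4\gamma_2)\big),\qquad m=\|A_0\|=\max\Big(\gamma_1,\sqrt{(\tfrac{\gamma_1}{2}+2\gamma_2)^2+\omega^2}\Big).$$ **Theorem.** $F_0$ is a smooth diffeomorphism of $\Theta$ onto an open subset of $(0,1)^4$, and all $\Delta_i$ are finite. For every $\theta\in\Theta$, as $(n,u_{\max})\to(\infty,\infty)$ jointly: 1. (Asymptotic unbiasedness.)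 $\mathbb P(\hat p\in F_0(\Theta))\to1$ and $\mathbb E[\hat\theta\mid\hat p\in F_0(\Theta)]\to\theta$. If the extension of $F_0^{-1}$ is bounded on $[0,1]^4$, then also $\mathbb E[\hat\theta]\to\theta$. Moreover $\sqrt n(\hat\theta-\mu)$ converges in law to $\mathcal N(0,\Sigma(F_0(\theta)))$. 2. (Ellipsoid and bias box.) For every $\alpha\in(0,1)$, $\mathbb P\big(\mu\in\hat\theta+\tfrac1{\sqrt n}\hat{\mathcal E}_\alpha\big)\to1-\alpha$. There is a function $\rho(u)=o(1/u)$, independent of $\theta$, such that for all large $u$ (depending on $\theta$) $\theta-\mu_u$ lies within distance $\rho(u)$ of $\tfrac1u\Delta$. 3. (Confidence region.) There is a function $r(n,u)=o\big(\tfrac1{\sqrt n}+\tfrac1u\big)$, independent of $\theta$ and $\alpha$, such that for every $\alpha\in(0,1)$ $$\liminf_{n,u_{\max}\to\infty}\ \mathbb P\Big(\theta\in\hat\theta+\tfrac1{\sqrt n}\hat{\mathcal E}_\alpha+\tfrac1{u_{\max}}\Delta+\bar B\big(0,r(n,u_{\max})\big)\Big)\ \ge\ 1-\alpha .$$ -/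

import Mathlib

open MeasureTheory ProbabilityTheory Filter Topology Asymptotics Set
open scoped Matrix Pointwise ContDiff ENNReal

noncomputable section

namespace OpenQubit

/-! Bloch vectors `(x, y, z)` are elements of `Fin 3 → ℝ`.  Parameter vectors are
`θ = (γ₁, κ, γ₂, ω) : Fin 4 → ℝ`, in this order; vectors of excitation probabilities also live
in `Fin 4 → ℝ`. -/

/-! ### Dynamics of the open qubit in the Bloch ball -/

/-- Generator of the rotations about the `z`-axis. -/
def Ωz : Matrix (Fin 3) (Fin 3) ℝ := !![0, -1, 0; 1, 0, 0; 0, 0, 0]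

/-- Generator of the rotations about the `x`-axis. -/
def Ωx : Matrix (Fin 3) (Fin 3) ℝ := !![0, 0, 0; 0, 0, -1; 0, 1, 0]

/-- Relaxation. -/
def Γ₁ : Matrix (Fin 3) (Fin 3) ℝ := Matrix.diagonal ![-1 / 2, -1 / 2, -1]

/-- Dephasing. -/
def Γ₂ : Matrix (Fin 3) (Fin 3) ℝ := Matrix.diagonal ![-2, -2, 0]

/-- `A_u = ω Ω_z + κ u Ω_x + γ₁ Γ₁ + γ₂ Γ₂`. -/
def genA (θ : Fin 4 → ℝ) (u : ℝ) : Matrix (Fin 3) (Fin 3) ℝ :=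
  θ 3 • Ωz + (θ 1 * u) • Ωx + θ 0 • Γ₁ + θ 2 • Γ₂

/-- The drift vector `b = (0, 0, γ₁)`. -/
def drift (θ : Fin 4 → ℝ) : Fin 3 → ℝ := ![0, 0, θ 0]

/-- State at time `t` of the solution of `v' = A_u v + b`, `v(0) = v₀`, for the constant
control `u`. -/
def flow (θ : Fin 4 → ℝ) (u t : ℝ) (v₀ : Fin 3 → ℝ) : Fin 3 → ℝ :=
  NormedSpace.exp (t • genA θ u) *ᵥ v₀ +
    ∫ s in (0 : ℝ)..t, NormedSpace.exp ((t - s) • genA θ u) *ᵥ drift θ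

/-- The instantaneous rotation `exp(φ Ω_x)`, ideal limit of an infinitely strong pulse. -/
def rotX (φ : ℝ) (v : Fin 3 → ℝ) : Fin 3 → ℝ := NormedSpace.exp (φ • Ωx) *ᵥ v

/-- The excited state (south pole). -/
def vExc : Fin 3 → ℝ := ![0, 0, -1]

/-- Probability of the excited outcome in the state `v`. -/
def excProb (v : Fin 3 → ℝ) : ℝ := (1 - v 2) / 2

/-- The four probabilities of the protocol, for a forward pulse `Pp` and an opposite pulse `Pm`:
relaxation during `t₁`; forward pulse; forward pulse, relaxation during `t₃`, opposite pulse;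
forward pulse, relaxation during `2 t₃`, opposite pulse. -/
def observables (θ : Fin 4 → ℝ) (t₁ t₃ : ℝ) (Pp Pm : (Fin 3 → ℝ) → (Fin 3 → ℝ)) : Fin 4 → ℝ :=
  ![excProb (flow θ 0 t₁ vExc),
    excProb (Pp vExc),
    excProb (Pm (flow θ 0 t₃ (Pp vExc))),
    excProb (Pm (flow θ 0 (2 * t₃) (Pp vExc)))]

/-! ### Prior box and experimental design -/

/-- A prior box `Θ = ∏ᵢ (lo i, hi i)` whose closure is a compact subset of `(0, ∞)⁴`, together
with the free design parameter `β ∈ (0, 1)` and the relaxation time `t₁`, the positive solution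
of `exp(γ̄₁ t₁) (2 - γ̄₁ t₁) = 2`. -/
structure Design where
  lo : Fin 4 → ℝ
  hi : Fin 4 → ℝ
  lo_pos : ∀ i, 0 < lo i
  lo_lt_hi : ∀ i, lo i < hi i
  β : ℝ
  β_pos : 0 < β
  β_lt_one : β < 1
  t₁ : ℝ
  t₁_pos : 0 < t₁
  t₁_eq : Real.exp (hi 0 * t₁) * (2 - hi 0 * t₁) = 2

namespace Design

/-- The open box `Θ` of admissible parameters. -/
def Θ (D : Design) : Set (Fin 4 → ℝ) := Set.univ.pi fun i => Ioo (D.lo i) (D.hi i)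

/-- Rescaled pulse duration `τ₂ = (1 - β) π / κ̄`. -/
def τ₂ (D : Design) : ℝ := (1 - D.β) * Real.pi / D.hi 1

/-- Relaxation time `t₃ = π / (ω_min + ω_max)`. -/
def t₃ (D : Design) : ℝ := Real.pi / (D.lo 3 + D.hi 3)

/-- The map `F_ε`, `ε = 1/u`, from parameters to observed probabilities, for saturated pulses of
amplitude `± u` and duration `τ₂ / u`. -/
def F (D : Design) (u : ℝ) (θ : Fin 4 → ℝ) : Fin 4 → ℝ :=
  observables θ D.t₁ D.t₃ (flow θ u (D.τ₂ / u)) (flow θ (-u) (D.τ₂ / u))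

/-- The ideal map `F_0`: the pulses are replaced by the rotations `exp(± κ τ₂ Ω_x)`. -/
def F₀ (D : Design) (θ : Fin 4 → ℝ) : Fin 4 → ℝ :=
  observables θ D.t₁ D.t₃ (rotX (θ 1 * D.τ₂)) (rotX (-(θ 1 * D.τ₂)))

end Design

/-- Jacobian matrix. -/
def jac (f : (Fin 4 → ℝ) → (Fin 4 → ℝ)) (x : Fin 4 → ℝ) : Matrix (Fin 4) (Fin 4) ℝ :=
  LinearMap.toMatrix' (fderiv ℝ f x : (Fin 4 → ℝ) →ₗ[ℝ] (Fin 4 → ℝ))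

/-! ### The box bounding the bias -/

/-- `λ = min(γ₁, (γ₁ + 4 γ₂)/2)`. -/
def decay (θ : Fin 4 → ℝ) : ℝ := min (θ 0) ((θ 0 + 4 * θ 2) / 2)

/-- `μ = max(γ₁, ((γ₁/2 + 2 γ₂)² + ω²)^{1/2})`, the operator norm of `A_0`. -/
def normA (θ : Fin 4 → ℝ) : ℝ := max (θ 0) (Real.sqrt ((θ 0 / 2 + 2 * θ 2) ^ 2 + θ 3 ^ 2))

namespace Design

/-- `C(θ) = τ₂/2 (μ + γ₁)`. -/
def C (D : Design) (θ : Fin 4 → ℝ) : ℝ := D.τ₂ / 2 * (normA θ + θ 0)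

/-- `C'(θ, t) = C(θ) + τ₂/2 (μ (2 e^{-λ t} - e^{-γ₁ t}) + γ₁ e^{-λ t})`. -/
def C' (D : Design) (θ : Fin 4 → ℝ) (t : ℝ) : ℝ :=
  D.C θ + D.τ₂ / 2 *
    (normA θ * (2 * Real.exp (-(decay θ * t)) - Real.exp (-(θ 0 * t)))
      + θ 0 * Real.exp (-(decay θ * t)))

/-- Half-widths of the box `Δ'(θ)` that bounds `(F_ε(θ) - F_0(θ)) / ε`. -/
def obsWidth (D : Design) (θ : Fin 4 → ℝ) : Fin 4 → ℝ :=
  ![0, D.C θ, D.C' θ D.t₃, D.C' θ (2 * D.t₃)]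

/-- The values `π_i [(Jac F_0(θ))⁻¹ δ]`, for `θ ∈ Θ` and `δ ∈ Δ'(θ)`. -/
def biasValues (D : Design) (i : Fin 4) : Set ℝ :=
  {x | ∃ θ ∈ D.Θ, ∃ δ ∈ Icc (-D.obsWidth θ) (D.obsWidth θ), x = ((jac D.F₀ θ)⁻¹ *ᵥ δ) i}

/-- The box `Δ = ∏ᵢ [-Δ_i, Δ_i]`, where `Δ_i` is the supremum of `biasValues i`. -/
def Δ (D : Design) : Set (Fin 4 → ℝ) :=
  Icc (fun i => -sSup (D.biasValues i)) (fun i => sSup (D.biasValues i))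

end Design

/-! ### Measurements, estimator and confidence region -/

/-- Empirical frequencies of the excited outcome after `n` repetitions of each of the four
experiments. -/
def empFreq {Ω : Type*} (ξ : Fin 4 → ℕ → Ω → Bool) (n : ℕ) (w : Ω) : Fin 4 → ℝ :=
  fun j => (∑ k ∈ Finset.range n, if ξ j k w then (1 : ℝ) else 0) / n

/-- The statistical model: `P θ u` is the law of the experiment for the parameter `θ` and the
pulse amplitude `u`, and `ξ j k` is the outcome of the `k`-th repetition of the `j`-th
experiment.  All outcomes are independent, and those of experiment `j` are Bernoulli with
parameter `F_{1/u}(θ)_j`. -/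
structure IsExperiment (D : Design) {Ω : Type*} [MeasurableSpace Ω]
    (P : (Fin 4 → ℝ) → ℝ → Measure Ω) (ξ : Fin 4 → ℕ → Ω → Bool) : Prop where
  measurable : ∀ j k, Measurable (ξ j k)
  indep : ∀ θ ∈ D.Θ, ∀ u > 0, iIndepFun (fun jk : Fin 4 × ℕ => ξ jk.1 jk.2) (P θ u)
  bernoulli : ∀ θ ∈ D.Θ, ∀ u > 0, ∀ j k, (P θ u).real {w | ξ j k w = true} = D.F u θ j

/-- The delta-method covariance `J diag(p) (1 - diag(p)) Jᵀ`, where `J` is the Jacobian of `G`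
at `p`. -/
def deltaCov (G : (Fin 4 → ℝ) → (Fin 4 → ℝ)) (p : Fin 4 → ℝ) : Matrix (Fin 4) (Fin 4) ℝ :=
  jac G p * (Matrix.diagonal p * (1 - Matrix.diagonal p)) * (jac G p)ᵀ

/-- The chi-square distribution with `k` degrees of freedom. -/
def chiSquare (k : ℕ) : Measure ℝ :=
  (Measure.pi fun _ : Fin k => gaussianReal 0 1).map fun z => ∑ i, z i ^ 2

/-- The quantile of order `q` of the chi-square distribution with `k` degrees of freedom. -/
def chiSquareQuantile (k : ℕ) (q : ℝ) : ℝ := sInf {x | q ≤ (chiSquare k).real (Iic x)}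

/-- The ellipsoid `{e | eᵀ Σ⁻¹ e ≤ χ²_{4,1-α}}` with `Σ = deltaCov G p`. -/
def ellipsoid (G : (Fin 4 → ℝ) → (Fin 4 → ℝ)) (α : ℝ) (p : Fin 4 → ℝ) : Set (Fin 4 → ℝ) :=
  {e | e ⬝ᵥ ((deltaCov G p)⁻¹ *ᵥ e) ≤ chiSquareQuantile 4 (1 - α)}

/-- The confidence region `θ̂ + n^{-1/2} Ê_α + u⁻¹ Δ + (ball of radius r)` computed from the
empirical frequencies `p`, where `θ̂ = G p`. -/
def Design.confRegion (D : Design) (G : (Fin 4 → ℝ) → (Fin 4 → ℝ)) (α : ℝ) (n : ℕ) (u r : ℝ)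
    (p : Fin 4 → ℝ) : Set (Fin 4 → ℝ) :=
  {G p} + (1 / Real.sqrt n) • ellipsoid G α p + (1 / u) • D.Δ + Metric.closedBall 0 r

end OpenQubit

end

/-! The limit map is inverted by hand. In the ideal protocol the first two probabilities are
`exp(-γ₁ t₁)` and `(1 + cos(κ τ₂))/2`, which give `γ₁` and `κ`. The other two then give `X = e^{-at}
cos(ωt)` and `Y = e^{-2at} cos(2ωt)` with `t = t₃`, `a = γ₁/2 + 2γ₂`, and the double-angle formula
`2X² - Y = e^{-2at}` separates `γ₂` from `ω`. The design keeps `κτ₂` and `ωt₃` inside `(0, π)` on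
the closed box, so this inverse is smooth near every image point, and compactness makes the suprema
`Δ_i` finite.

The bias is deterministic. Undoing the rotation during a pulse of duration `τ₂/u` leaves a velocity
bounded by `m + γ₁`, because the Bloch ball is invariant. Contraction during the relaxation then
gives `|F - F₀| ≤ obsWidth/u` coordinatewise (`abs_F_sub_F₀_le`). A second-order Taylor expansion of
the inverse turns this into the box `Δ/u` up to `O(u⁻²)` (`bias_mem`).

The fluctuations are governed by a central limit theorem for Bernoulli variables whose parameters
move with `u`, proved with characteristic functions (`tendstoInDistribution_stdFreq`). Every
statistic is a function of the standardised frequencies that converges continuously to a function of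
the Gaussian limit. An extended continuous mapping theorem (`tendsto_integral_comp`,
`comp_of_tendsto`) therefore yields consistency, the delta method and the chi-square limit of the
plug-in quadratic form. The confidence region follows by adding `μ ∈ θ̂ + Ê/√n` and `θ - μ ∈ Δ/u +
o(1/u)`. -/

namespace OpenQubit

/-! ### Linear differential equations and variation of constants. -/

section LinearODE

open scoped Matrix.Norms.Operator

variable {ι : Type*} [Fintype ι] [DecidableEq ι]

/-- Product rule with `A` moved to the right of the exponential, so that both contributions sit
under it. The free inner function `f` serves the integrating factor `f s = t - s` as well as a
moving rotation angle. -/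
theorem hasDerivAt_exp_smul_mulVec (A : Matrix ι ι ℝ) {f : ℝ → ℝ} {f' : ℝ} {y : ℝ → ι → ℝ}
    {y' : ι → ℝ} {t : ℝ} (hf : HasDerivAt f f' t) (hy : HasDerivAt y y' t) :
    HasDerivAt (fun s => NormedSpace.exp (f s • A) *ᵥ y s)
      (NormedSpace.exp (f t • A) *ᵥ (y' + f' • (A *ᵥ y t))) t := by
  have h1 : HasDerivAt (fun s => NormedSpace.exp (f s • A)) (f' • (NormedSpace.exp (f t • A) * A)) t :=
    HasDerivAt.scomp t (hasDerivAt_exp_smul_const A (f t)) hf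
  rw [hasDerivAt_pi] at hy ⊢
  intro i
  have h2 : ∀ j, HasDerivAt (fun s => NormedSpace.exp (f s • A) i j)
      ((f' • (NormedSpace.exp (f t • A) * A)) i j) t := fun j =>
    hasDerivAt_pi.1 (hasDerivAt_pi.1 h1 i) j
  have h3 := HasDerivAt.fun_sum (u := Finset.univ) fun j _ => (h2 j).mul (hy j)
  refine h3.congr_deriv ?_
  rw [Finset.sum_add_distrib, add_comm, Matrix.mulVec_add, Matrix.mulVec_smul,
    Matrix.mulVec_mulVec, ← Matrix.smul_mulVec]
  rfl

theorem exp_sub_smul_mulVec (A : Matrix ι ι ℝ) (s t : ℝ) (b : ι → ℝ) :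
    NormedSpace.exp ((t - s) • A) *ᵥ b
      = NormedSpace.exp (t • A) *ᵥ (NormedSpace.exp ((-s) • A) *ᵥ b) := by
  rw [Matrix.mulVec_mulVec, ← Matrix.exp_add_of_commute, ← add_smul, sub_eq_add_neg]
  exact ((Commute.refl A).smul_left _).smul_right _

theorem continuous_exp_smul_mulVec (A : Matrix ι ι ℝ) {f : ℝ → ℝ} (hf : Continuous f)
    (b : ι → ℝ) : Continuous fun s => NormedSpace.exp (f s • A) *ᵥ b := by
  have : Continuous fun s : ℝ => NormedSpace.exp (s • A) *ᵥ b :=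
    continuous_iff_continuousAt.2 fun s =>
      (hasDerivAt_exp_smul_mulVec A (hasDerivAt_id s) (hasDerivAt_const s b)).continuousAt
  exact this.comp hf

/-- Variation of constants. -/
theorem eq_exp_smul_mulVec_add_integral (A : Matrix ι ι ℝ) (b : ι → ℝ) {y : ℝ → ι → ℝ}
    (hy : ∀ s, HasDerivAt y (A *ᵥ y s + b) s) (t : ℝ) :
    y t = NormedSpace.exp (t • A) *ᵥ y 0
      + ∫ s in (0 : ℝ)..t, NormedSpace.exp ((t - s) • A) *ᵥ b := by
  have h : ∀ s ∈ uIcc 0 t, HasDerivAt (fun s => NormedSpace.exp ((t - s) • A) *ᵥ y s)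
      (NormedSpace.exp ((t - s) • A) *ᵥ b) s := by
    intro s _
    refine (hasDerivAt_exp_smul_mulVec A ((hasDerivAt_id s).const_sub t) (hy s)).congr_deriv ?_
    congr 1
    module
  rw [intervalIntegral.integral_eq_sub_of_hasDerivAt h
    ((continuous_exp_smul_mulVec A (by fun_prop) b).intervalIntegrable _ _)]
  simp

/-- Factoring `exp(tA)` out of the integral removes `t` from the integrand; the product rule and the
fundamental theorem of calculus then suffice. -/
theorem hasDerivAt_exp_smul_mulVec_add_integral (A : Matrix ι ι ℝ) (b v : ι → ℝ) (t : ℝ) :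
    HasDerivAt (fun t => NormedSpace.exp (t • A) *ᵥ v
        + ∫ s in (0 : ℝ)..t, NormedSpace.exp ((t - s) • A) *ᵥ b)
      (A *ᵥ (NormedSpace.exp (t • A) *ᵥ v
        + ∫ s in (0 : ℝ)..t, NormedSpace.exp ((t - s) • A) *ᵥ b) + b) t := by
  have hc : Continuous fun s : ℝ => NormedSpace.exp ((-s) • A) *ᵥ b :=
    continuous_exp_smul_mulVec A (by fun_prop) b
  have key : ∀ t : ℝ, NormedSpace.exp (t • A) *ᵥ v
        + ∫ s in (0 : ℝ)..t, NormedSpace.exp ((t - s) • A) *ᵥ b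
      = NormedSpace.exp (t • A) *ᵥ (v + ∫ s in (0 : ℝ)..t, NormedSpace.exp ((-s) • A) *ᵥ b) := by
    intro t
    simp_rw [exp_sub_smul_mulVec A _ t b]
    rw [Matrix.mulVec_add]
    congr 1
    exact ContinuousLinearMap.intervalIntegral_comp_comm
      (LinearMap.toContinuousLinearMap (Matrix.mulVecLin (NormedSpace.exp (t • A))))
      (hc.intervalIntegrable _ _)
  have hcomm : ∀ x : ι → ℝ, NormedSpace.exp (t • A) *ᵥ (A *ᵥ x)
      = A *ᵥ (NormedSpace.exp (t • A) *ᵥ x) := by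
    intro x
    rw [Matrix.mulVec_mulVec, Matrix.mulVec_mulVec]
    congr 1
    exact (((Commute.refl A).smul_left t).exp_left).eq
  simp_rw [key]
  refine (hasDerivAt_exp_smul_mulVec A (hasDerivAt_id t)
    ((intervalIntegral.integral_hasDerivAt_right (hc.intervalIntegrable _ _)
      (hc.stronglyMeasurableAtFilter _ _) hc.continuousAt).const_add v)).congr_deriv ?_
  simp only [id, one_smul]
  rw [Matrix.mulVec_add, hcomm, add_comm, ← exp_sub_smul_mulVec A t t b]
  simp

end LinearODE

/-! ### Explicit flows and pulse errors in the Bloch ball. -/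

theorem flow_zero (θ : Fin 4 → ℝ) (u : ℝ) (v : Fin 3 → ℝ) : flow θ u 0 v = v := by
  simp [flow]

theorem hasDerivAt_flow (θ : Fin 4 → ℝ) (u t : ℝ) (v : Fin 3 → ℝ) :
    HasDerivAt (fun t => flow θ u t v) (genA θ u *ᵥ flow θ u t v + drift θ) t :=
  hasDerivAt_exp_smul_mulVec_add_integral _ _ _ _

/-- Uniqueness: a closed formula for the flow is proved by checking the differential equation on a
guessed solution. -/
theorem flow_eq_of_hasDerivAt {θ : Fin 4 → ℝ} {u : ℝ} {y : ℝ → Fin 3 → ℝ}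
    (hy : ∀ s, HasDerivAt y (genA θ u *ᵥ y s + drift θ) s) (t : ℝ) :
    flow θ u t (y 0) = y t :=
  (eq_exp_smul_mulVec_add_integral _ _ hy t).symm

theorem hasDerivAt_vec3 {f g h : ℝ → ℝ} {f' g' h' t : ℝ} (hf : HasDerivAt f f' t)
    (hg : HasDerivAt g g' t) (hh : HasDerivAt h h' t) :
    HasDerivAt (fun t => ![f t, g t, h t]) ![f', g', h'] t := by
  rw [hasDerivAt_pi]
  intro i
  fin_cases i <;> assumption

theorem genA_mulVec (θ : Fin 4 → ℝ) (u : ℝ) (v : Fin 3 → ℝ) :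
    genA θ u *ᵥ v = ![-(θ 0 / 2 + 2 * θ 2) * v 0 - θ 3 * v 1,
      θ 3 * v 0 - (θ 0 / 2 + 2 * θ 2) * v 1 - θ 1 * u * v 2,
      θ 1 * u * v 1 - θ 0 * v 2] := by
  ext i
  fin_cases i <;>
    simp [genA, Ωx, Ωz, Γ₁, Γ₂, Matrix.mulVec, dotProduct, Fin.sum_univ_three,
      Matrix.diagonal_apply] <;> ring

theorem rotX_eq (φ : ℝ) (v : Fin 3 → ℝ) :
    rotX φ v = ![v 0, Real.cos φ * v 1 - Real.sin φ * v 2,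
      Real.sin φ * v 1 + Real.cos φ * v 2] := by
  have h := eq_exp_smul_mulVec_add_integral Ωx 0
    (y := fun φ => ![v 0, Real.cos φ * v 1 - Real.sin φ * v 2,
      Real.sin φ * v 1 + Real.cos φ * v 2]) (fun s => ?_) φ
  · have h0 : ![v 0, v 1, v 2] = v := by ext i; fin_cases i <;> rfl
    simp only [Matrix.mulVec_zero, intervalIntegral.integral_zero, add_zero, Real.cos_zero,
      Real.sin_zero, one_mul, zero_mul, sub_zero, zero_add, h0] at h
    exact h.symm
  · refine (hasDerivAt_vec3 (hasDerivAt_const s (v 0))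
      (((Real.hasDerivAt_cos s).mul_const (v 1)).sub ((Real.hasDerivAt_sin s).mul_const (v 2)))
      (((Real.hasDerivAt_sin s).mul_const (v 1)).add
        ((Real.hasDerivAt_cos s).mul_const (v 2)))).congr_deriv ?_
    ext i
    fin_cases i <;> simp [Ωx] <;> ring

theorem flow_zero_control (θ : Fin 4 → ℝ) (t : ℝ) (v : Fin 3 → ℝ) :
    flow θ 0 t v =
      ![Real.exp (-((θ 0 / 2 + 2 * θ 2) * t)) * (Real.cos (θ 3 * t) * v 0 - Real.sin (θ 3 * t) * v 1),
        Real.exp (-((θ 0 / 2 + 2 * θ 2) * t)) * (Real.sin (θ 3 * t) * v 0 + Real.cos (θ 3 * t) * v 1),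
        Real.exp (-(θ 0 * t)) * v 2 + (1 - Real.exp (-(θ 0 * t)))] := by
  have h := flow_eq_of_hasDerivAt (θ := θ) (u := 0) (y := fun t =>
    ![Real.exp (-((θ 0 / 2 + 2 * θ 2) * t)) * (Real.cos (θ 3 * t) * v 0 - Real.sin (θ 3 * t) * v 1),
        Real.exp (-((θ 0 / 2 + 2 * θ 2) * t)) * (Real.sin (θ 3 * t) * v 0 + Real.cos (θ 3 * t) * v 1),
        Real.exp (-(θ 0 * t)) * v 2 + (1 - Real.exp (-(θ 0 * t)))]) (fun s => ?_) t
  · have h0 : ![v 0, v 1, v 2] = v := by ext i; fin_cases i <;> rfl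
    simpa [h0] using h
  · have he : ∀ a : ℝ, HasDerivAt (fun t => Real.exp (-(a * t))) (-a * Real.exp (-(a * s))) s := by
      intro a
      refine (((hasDerivAt_id s).const_mul a).neg.exp).congr_deriv ?_
      simp; ring
    have hc : HasDerivAt (fun t => Real.cos (θ 3 * t)) (-θ 3 * Real.sin (θ 3 * s)) s := by
      refine (((hasDerivAt_id s).const_mul (θ 3)).cos).congr_deriv ?_
      simp; ring
    have hs : HasDerivAt (fun t => Real.sin (θ 3 * t)) (θ 3 * Real.cos (θ 3 * s)) s := by
      refine (((hasDerivAt_id s).const_mul (θ 3)).sin).congr_deriv ?_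
      simp; ring
    refine (hasDerivAt_vec3
      ((he (θ 0 / 2 + 2 * θ 2)).mul ((hc.mul_const (v 0)).sub (hs.mul_const (v 1))))
      ((he (θ 0 / 2 + 2 * θ 2)).mul ((hs.mul_const (v 0)).add (hc.mul_const (v 1))))
      (((he (θ 0)).mul_const (v 2)).add ((he (θ 0)).const_sub 1))).congr_deriv ?_
    rw [genA_mulVec]
    ext i
    fin_cases i <;> simp [drift] <;> ring

/-- Euclidean norm of a Bloch vector. -/
noncomputable def blochNorm (v : Fin 3 → ℝ) : ℝ := ‖WithLp.toLp 2 v‖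

theorem blochNorm_sq (v : Fin 3 → ℝ) : blochNorm v ^ 2 = v 0 ^ 2 + v 1 ^ 2 + v 2 ^ 2 := by
  rw [blochNorm, EuclideanSpace.real_norm_sq_eq, Fin.sum_univ_three]

theorem blochNorm_nonneg (v : Fin 3 → ℝ) : 0 ≤ blochNorm v := norm_nonneg _

theorem blochNorm_add_le (v w : Fin 3 → ℝ) : blochNorm (v + w) ≤ blochNorm v + blochNorm w := by
  rw [blochNorm, WithLp.toLp_add]
  exact norm_add_le _ _

theorem abs_apply_two_le_blochNorm (v : Fin 3 → ℝ) : |v 2| ≤ blochNorm v := by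
  apply abs_le_of_sq_le_sq _ (blochNorm_nonneg v)
  rw [blochNorm_sq]
  nlinarith [sq_nonneg (v 0), sq_nonneg (v 1)]

theorem blochNorm_rotX (φ : ℝ) (v : Fin 3 → ℝ) : blochNorm (rotX φ v) = blochNorm v := by
  have h : blochNorm (rotX φ v) ^ 2 = blochNorm v ^ 2 := by
    rw [blochNorm_sq, blochNorm_sq, rotX_eq]
    simp
    linear_combination (v 1 ^ 2 + v 2 ^ 2) * Real.sin_sq_add_cos_sq φ
  exact (pow_left_inj₀ (blochNorm_nonneg _) (blochNorm_nonneg _) two_ne_zero).1 h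

theorem rotX_sub (φ : ℝ) (v w : Fin 3 → ℝ) : rotX φ (v - w) = rotX φ v - rotX φ w :=
  Matrix.mulVec_sub _ _ _

theorem rotX_rotX_neg (φ : ℝ) (v : Fin 3 → ℝ) : rotX φ (rotX (-φ) v) = v := by
  rw [rotX_eq, rotX_eq]
  ext i
  fin_cases i <;> simp
  · linear_combination v 1 * Real.sin_sq_add_cos_sq φ
  · linear_combination v 2 * Real.sin_sq_add_cos_sq φ

theorem excProb_sub_excProb_abs_le (v w : Fin 3 → ℝ) :
    |excProb v - excProb w| ≤ blochNorm (v - w) / 2 := by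
  have h : excProb v - excProb w = -((v - w) 2 / 2) := by
    simp [excProb]; ring
  rw [h, abs_neg, abs_div, abs_two]
  gcongr
  exact abs_apply_two_le_blochNorm _

theorem normA_nonneg (θ : Fin 4 → ℝ) : 0 ≤ normA θ :=
  (Real.sqrt_nonneg _).trans (le_max_right _ _)

/-- Without control the `z`-axis decouples, and the `xy`-block is a rotation scaled by the square
root in `normA`. -/
theorem blochNorm_genA_zero_mulVec_le {θ : Fin 4 → ℝ} (h0 : 0 ≤ θ 0) (v : Fin 3 → ℝ) :
    blochNorm (genA θ 0 *ᵥ v) ≤ normA θ * blochNorm v := by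
  have hn := normA_nonneg θ
  apply le_of_sq_le_sq _ (mul_nonneg hn (blochNorm_nonneg v))
  have h1 : θ 0 ^ 2 ≤ normA θ ^ 2 := pow_le_pow_left₀ h0 (le_max_left _ _) 2
  have h2 : (θ 0 / 2 + 2 * θ 2) ^ 2 + θ 3 ^ 2 ≤ normA θ ^ 2 := by
    rw [← Real.sqrt_le_left hn]
    exact le_max_right _ _
  rw [mul_pow, blochNorm_sq, blochNorm_sq, genA_mulVec]
  simp
  nlinarith [mul_le_mul_of_nonneg_right h1 (sq_nonneg (v 2)),
    mul_le_mul_of_nonneg_right h2 (add_nonneg (sq_nonneg (v 0)) (sq_nonneg (v 1)))]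

theorem blochNorm_drift {θ : Fin 4 → ℝ} (h0 : 0 ≤ θ 0) : blochNorm (drift θ) = θ 0 := by
  refine (pow_left_inj₀ (blochNorm_nonneg _) h0 two_ne_zero).1 ?_
  rw [blochNorm_sq]
  simp [drift]

/-- The Bloch ball is invariant under the flow. -/
theorem blochNorm_flow_le_one {θ : Fin 4 → ℝ} (h0 : 0 ≤ θ 0) (h2 : 0 ≤ θ 2) (u : ℝ) {t : ℝ}
    (ht : 0 ≤ t) {v : Fin 3 → ℝ} (hv : blochNorm v ≤ 1) : blochNorm (flow θ u t v) ≤ 1 := by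
  set x : ℝ → Fin 3 → ℝ := fun t => flow θ u t v with hx
  -- The skew parts `ω` and `κu` do not change `|x|²`. The weight `e^{γ₁ t}` completes the square in
  -- `z`, so that the derivative is visibly nonpositive.
  let g : ℝ → ℝ := fun t => Real.exp (θ 0 * t) * (x t 0 ^ 2 + x t 1 ^ 2 + x t 2 ^ 2 - 1)
  have hd : ∀ t, HasDerivAt g (Real.exp (θ 0 * t) *
      (-4 * θ 2 * (x t 0 ^ 2 + x t 1 ^ 2) - θ 0 * (x t 2 - 1) ^ 2)) t := by
    intro t
    have hxt := hasDerivAt_pi.1 (hasDerivAt_flow θ u t v)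
    have he : HasDerivAt (fun t => Real.exp (θ 0 * t)) (Real.exp (θ 0 * t) * (θ 0)) t := by
      simpa using ((hasDerivAt_id t).const_mul (θ 0)).exp
    refine (he.mul (((((hxt 0).pow 2).add ((hxt 1).pow 2)).add ((hxt 2).pow 2)).sub_const 1)).congr_deriv ?_
    rw [genA_mulVec]
    simp [drift, hx]
    ring
  have hanti : Antitone g := antitone_of_hasDerivAt_nonpos hd fun t => by
    have := sq_nonneg (x t 0)
    have := sq_nonneg (x t 1)
    refine mul_nonpos_of_nonneg_of_nonpos (Real.exp_pos _).le ?_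
    have h3 : 0 ≤ θ 2 * (x t 0 ^ 2 + x t 1 ^ 2) := by positivity
    have h4 : 0 ≤ θ 0 * (x t 2 - 1) ^ 2 := by positivity
    linarith
  have hg : g t ≤ g 0 := hanti ht
  have hv2 := pow_le_one₀ (n := 2) (blochNorm_nonneg v) hv
  rw [blochNorm_sq] at hv2
  have hg0 : g 0 ≤ 0 := by
    simp only [g, hx, flow_zero, mul_zero, Real.exp_zero, one_mul]
    linarith
  have hgt : x t 0 ^ 2 + x t 1 ^ 2 + x t 2 ^ 2 - 1 ≤ 0 :=
    nonpos_of_mul_nonpos_right (hg.trans hg0) (Real.exp_pos _)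
  apply le_of_sq_le_sq _ zero_le_one
  rw [blochNorm_sq]
  change x t 0 ^ 2 + x t 1 ^ 2 + x t 2 ^ 2 ≤ 1 ^ 2
  linarith

/-- Comparison of the controlled flow with the rotation generated by the control. -/
theorem blochNorm_flow_sub_rotX_le {θ : Fin 4 → ℝ} (h0 : 0 ≤ θ 0) (h2 : 0 ≤ θ 2) (u : ℝ) {t : ℝ}
    (ht : 0 ≤ t) {v : Fin 3 → ℝ} (hv : blochNorm v ≤ 1) :
    blochNorm (flow θ u t v - rotX (θ 1 * u * t) v) ≤ t * (normA θ + θ 0) := by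
  -- Interaction picture: undoing the rotation cancels the control term and leaves the rotated
  -- vector `A₀ v + b`. The mean value inequality is applied in `EuclideanSpace`, whose norm
  -- rotations preserve.
  let w : ℝ → Fin 3 → ℝ := fun s => rotX (-(θ 1 * u * s)) (flow θ u s v)
  have hw : ∀ s, HasDerivAt w
      (rotX (-(θ 1 * u * s)) (genA θ 0 *ᵥ flow θ u s v + drift θ)) s := by
    intro s
    have hl : HasDerivAt (fun s => -(θ 1 * u * s)) (-(θ 1 * u)) s := by
      simpa using ((hasDerivAt_id s).const_mul (θ 1 * u)).fun_neg
    refine (hasDerivAt_exp_smul_mulVec Ωx hl (hasDerivAt_flow θ u s v)).congr_deriv ?_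
    rw [rotX]
    congr 1
    simp only [genA, Matrix.add_mulVec, Matrix.smul_mulVec]
    module
  have hmv := norm_image_sub_le_of_norm_deriv_le_segment' (a := 0) (b := t)
    (f := fun s => (WithLp.toLp 2 (w s) : EuclideanSpace ℝ (Fin 3)))
    (f' := fun s => WithLp.toLp 2 (rotX (-(θ 1 * u * s)) (genA θ 0 *ᵥ flow θ u s v + drift θ)))
    (C := normA θ + θ 0)
    (fun s _ => ((PiLp.continuousLinearEquiv 2 ℝ (fun _ : Fin 3 => ℝ)).symm.hasFDerivAt.comp_hasDerivAt
      s (hw s)).hasDerivWithinAt)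
    (fun s hs => by
      change blochNorm _ ≤ _
      rw [blochNorm_rotX]
      refine (blochNorm_add_le _ _).trans ?_
      rw [blochNorm_drift h0]
      gcongr
      refine (blochNorm_genA_zero_mulVec_le h0 _).trans ?_
      exact mul_le_of_le_one_right (normA_nonneg θ) (blochNorm_flow_le_one h0 h2 u hs.1 hv))
    t (right_mem_Icc.2 ht)
  rw [← WithLp.toLp_sub, sub_zero, mul_comm] at hmv
  refine le_trans (le_of_eq ?_) hmv
  change _ = blochNorm (w t - w 0)
  have hw0 : w 0 = v := by simp [w, flow_zero, rotX]
  rw [hw0, ← blochNorm_rotX (θ 1 * u * t) (w t - v), rotX_sub, rotX_rotX_neg]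

theorem blochNorm_flow_zero_control_sub_le (θ : Fin 4 → ℝ) {t : ℝ} (ht : 0 ≤ t)
    (v w : Fin 3 → ℝ) :
    blochNorm (flow θ 0 t v - flow θ 0 t w) ≤ Real.exp (-(decay θ * t)) * blochNorm (v - w) := by
  apply le_of_sq_le_sq _ (mul_nonneg (Real.exp_pos _).le (blochNorm_nonneg _))
  have h1 : Real.exp (-((θ 0 / 2 + 2 * θ 2) * t)) ^ 2 ≤ Real.exp (-(decay θ * t)) ^ 2 := by
    gcongr
    exact (min_le_right _ _).trans_eq (by ring)
  have h2 : Real.exp (-(θ 0 * t)) ^ 2 ≤ Real.exp (-(decay θ * t)) ^ 2 := by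
    gcongr
    exact min_le_left _ _
  rw [mul_pow, blochNorm_sq, blochNorm_sq, flow_zero_control, flow_zero_control]
  simp
  set a := v 0 - w 0
  set b := v 1 - w 1
  set c := v 2 - w 2
  have key := Real.sin_sq_add_cos_sq (θ 3 * t)
  calc _ = Real.exp (-((θ 0 / 2 + 2 * θ 2) * t)) ^ 2 * (a ^ 2 + b ^ 2)
        + Real.exp (-(θ 0 * t)) ^ 2 * c ^ 2 := by
        simp only [a, b, c]
        linear_combination Real.exp (-((θ 0 / 2 + 2 * θ 2) * t)) ^ 2 * (a ^ 2 + b ^ 2) * key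
    _ ≤ Real.exp (-(decay θ * t)) ^ 2 * (a ^ 2 + b ^ 2) + Real.exp (-(decay θ * t)) ^ 2 * c ^ 2 := by
        gcongr
    _ = _ := by ring

theorem blochNorm_vExc : blochNorm vExc ≤ 1 := by
  apply le_of_sq_le_sq _ zero_le_one
  rw [blochNorm_sq]
  simp [vExc]

/-! ### Distance between the real and the ideal protocol. -/

namespace Design

variable (D : Design)

theorem hi_pos (i : Fin 4) : 0 < D.hi i := (D.lo_pos i).trans (D.lo_lt_hi i)

theorem τ₂_pos : 0 < D.τ₂ :=
  div_pos (mul_pos (sub_pos.2 D.β_lt_one) Real.pi_pos) (D.hi_pos 1)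

theorem t₃_pos : 0 < D.t₃ := div_pos Real.pi_pos (add_pos (D.lo_pos 3) (D.hi_pos 3))

variable {D}

theorem pos_of_mem_Θ {θ : Fin 4 → ℝ} (hθ : θ ∈ D.Θ) (i : Fin 4) : 0 < θ i :=
  (D.lo_pos i).trans (hθ i trivial).1

theorem blochNorm_pulse_sub_rotX_le {θ : Fin 4 → ℝ} (hθ : θ ∈ D.Θ) {u : ℝ} (hu : 0 < u)
    {v : Fin 3 → ℝ} (hv : blochNorm v ≤ 1) :
    blochNorm (flow θ u (D.τ₂ / u) v - rotX (θ 1 * D.τ₂) v) ≤ D.τ₂ / u * (normA θ + θ 0) ∧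
    blochNorm (flow θ (-u) (D.τ₂ / u) v - rotX (-(θ 1 * D.τ₂)) v)
      ≤ D.τ₂ / u * (normA θ + θ 0) := by
  have ht : 0 ≤ D.τ₂ / u := (div_pos D.τ₂_pos hu).le
  constructor
  · have := blochNorm_flow_sub_rotX_le (pos_of_mem_Θ hθ 0).le (pos_of_mem_Θ hθ 2).le u ht hv
    rwa [show θ 1 * u * (D.τ₂ / u) = θ 1 * D.τ₂ by field_simp] at this
  · have := blochNorm_flow_sub_rotX_le (pos_of_mem_Θ hθ 0).le (pos_of_mem_Θ hθ 2).le (-u) ht hv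
    rwa [show θ 1 * -u * (D.τ₂ / u) = -(θ 1 * D.τ₂) by field_simp] at this

/-- Two errors add up: that of the second pulse, and that of the first pulse contracted by
`e^{-λt}`. The constant `C'` exceeds their sum by the nonnegative term `τ₂/2 · m (e^{-λt} -
e^{-γ₁t})`, which is `e8` up to scaling. -/
theorem abs_pulsed_relaxation_sub_le {θ : Fin 4 → ℝ} (hθ : θ ∈ D.Θ) {u : ℝ} (hu : 0 < u)
    {t : ℝ} (ht : 0 ≤ t) :
    |excProb (flow θ (-u) (D.τ₂ / u) (flow θ 0 t (flow θ u (D.τ₂ / u) vExc)))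
      - excProb (rotX (-(θ 1 * D.τ₂)) (flow θ 0 t (rotX (θ 1 * D.τ₂) vExc)))|
      ≤ 1 / u * D.C' θ t := by
  have h0 := pos_of_mem_Θ hθ 0
  have h2 := pos_of_mem_Θ hθ 2
  have hp := (div_pos D.τ₂_pos hu).le
  set x := flow θ u (D.τ₂ / u) vExc
  set y := rotX (θ 1 * D.τ₂) vExc
  have hx : blochNorm x ≤ 1 := blochNorm_flow_le_one h0.le h2.le _ hp blochNorm_vExc
  have hxt : blochNorm (flow θ 0 t x) ≤ 1 := blochNorm_flow_le_one h0.le h2.le _ ht hx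
  have e1 := (blochNorm_pulse_sub_rotX_le hθ hu hxt).2
  have e2 := (blochNorm_pulse_sub_rotX_le hθ hu blochNorm_vExc).1
  have e3 := blochNorm_flow_zero_control_sub_le θ ht x y
  have e4 := blochNorm_add_le (flow θ (-u) (D.τ₂ / u) (flow θ 0 t x)
    - rotX (-(θ 1 * D.τ₂)) (flow θ 0 t x))
    (rotX (-(θ 1 * D.τ₂)) (flow θ 0 t x) - rotX (-(θ 1 * D.τ₂)) (flow θ 0 t y))
  rw [sub_add_sub_cancel, ← rotX_sub, blochNorm_rotX] at e4
  have e5 := excProb_sub_excProb_abs_le (flow θ (-u) (D.τ₂ / u) (flow θ 0 t x))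
    (rotX (-(θ 1 * D.τ₂)) (flow θ 0 t y))
  have e6 : Real.exp (-(decay θ * t)) * blochNorm (x - y)
      ≤ Real.exp (-(decay θ * t)) * (D.τ₂ / u * (normA θ + θ 0)) := by gcongr
  have e7 : Real.exp (-(θ 0 * t)) ≤ Real.exp (-(decay θ * t)) := by
    gcongr
    exact min_le_left _ _
  have e8 : 0 ≤ D.τ₂ / u * normA θ * (Real.exp (-(decay θ * t)) - Real.exp (-(θ 0 * t))) :=
    mul_nonneg (mul_nonneg hp (normA_nonneg θ)) (sub_nonneg.2 e7)
  have e9 : 1 / u * D.C' θ t = (D.τ₂ / u * (normA θ + θ 0)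
      + Real.exp (-(decay θ * t)) * (D.τ₂ / u * (normA θ + θ 0))
      + D.τ₂ / u * normA θ * (Real.exp (-(decay θ * t)) - Real.exp (-(θ 0 * t)))) / 2 := by
    simp only [C', C]
    ring
  rw [e9]
  linarith

theorem abs_F_sub_F₀_le {θ : Fin 4 → ℝ} (hθ : θ ∈ D.Θ) {u : ℝ} (hu : 0 < u) (j : Fin 4) :
    |(D.F u θ - D.F₀ θ) j| ≤ 1 / u * D.obsWidth θ j := by
  have ht := D.t₃_pos.le
  fin_cases j
  · simp [F, F₀, observables, obsWidth]
  · have e := (blochNorm_pulse_sub_rotX_le hθ hu blochNorm_vExc).1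
    have e5 := (excProb_sub_excProb_abs_le (flow θ u (D.τ₂ / u) vExc)
      (rotX (θ 1 * D.τ₂) vExc)).trans (div_le_div_of_nonneg_right e zero_le_two)
    refine e5.trans_eq ?_
    simp [obsWidth, C]
    ring
  · exact abs_pulsed_relaxation_sub_le hθ hu ht
  · exact abs_pulsed_relaxation_sub_le hθ hu (mul_nonneg zero_le_two ht)

theorem tendsto_F (D : Design) {θ : Fin 4 → ℝ} (hθ : θ ∈ D.Θ) :
    Tendsto (fun u => D.F u θ) atTop (𝓝 (D.F₀ θ)) := by
  rw [tendsto_pi_nhds]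
  intro j
  rw [tendsto_iff_norm_sub_tendsto_zero]
  refine squeeze_zero' (Eventually.of_forall fun _ => norm_nonneg _)
    ((eventually_gt_atTop 0).mono fun u hu => abs_F_sub_F₀_le hθ hu j) ?_
  simpa using (tendsto_inv_atTop_zero (𝕜 := ℝ)).mul_const (D.obsWidth θ j)

end Design

/-! ### Explicit inversion of the ideal map. -/

namespace Design

/-- The probability measured after a forward pulse of angle `φ`, relaxation during `t` and an
opposite pulse. -/
noncomputable def pulsedProb (t a ν γ φ : ℝ) : ℝ :=
  (1 + Real.exp (-(a * t)) * Real.cos (ν * t) * Real.sin φ ^ 2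
    - Real.cos φ * (1 - Real.exp (-(γ * t)) * (1 + Real.cos φ))) / 2

theorem F₀_eq (D : Design) (θ : Fin 4 → ℝ) :
    D.F₀ θ = ![Real.exp (-(θ 0 * D.t₁)), (1 + Real.cos (θ 1 * D.τ₂)) / 2,
      pulsedProb D.t₃ (θ 0 / 2 + 2 * θ 2) (θ 3) (θ 0) (θ 1 * D.τ₂),
      pulsedProb (2 * D.t₃) (θ 0 / 2 + 2 * θ 2) (θ 3) (θ 0) (θ 1 * D.τ₂)] := by
  ext i
  fin_cases i <;>
    simp [F₀, observables, excProb, flow_zero_control, rotX_eq, vExc, pulsedProb] <;> ring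

theorem contDiff_F₀ (D : Design) : ContDiff ℝ ∞ D.F₀ := by
  rw [funext D.F₀_eq, contDiff_pi]
  intro i
  fin_cases i <;> simp [pulsedProb] <;> fun_prop

/-- An explicit inverse of `F_0`. -/
noncomputable def F₀Inv (D : Design) (p : Fin 4 → ℝ) : Fin 4 → ℝ :=
  let γ := -Real.log (p 0) / D.t₁
  let c := 2 * p 1 - 1
  let X := (2 * p 2 - 1 + c * (1 - Real.exp (-(γ * D.t₃)) * (1 + c))) / (1 - c ^ 2)
  let Y := (2 * p 3 - 1 + c * (1 - Real.exp (-(γ * (2 * D.t₃))) * (1 + c))) / (1 - c ^ 2)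
  let S := 2 * X ^ 2 - Y
  ![γ, Real.arccos c / D.τ₂, (-Real.log S / (2 * D.t₃) - γ / 2) / 2,
    Real.arccos (X / Real.sqrt S) / D.t₃]

/-- The open set of parameters on which `F_0` is inverted by `F₀Inv`. -/
def goodSet (D : Design) : Set (Fin 4 → ℝ) :=
  {θ | θ 1 * D.τ₂ ∈ Ioo 0 Real.pi ∧ θ 3 * D.t₃ ∈ Ioo 0 Real.pi}

variable {D : Design} {θ : Fin 4 → ℝ}

/-- This is the purpose of `τ₂` and `t₃`: on the box `κτ₂ ≤ (1-β)π` and `ωt₃ ≤ π ω̄/(ω̲+ω̄)`, both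
below `π`. Having the closed box inside is what later allows a compactness argument. -/
theorem Icc_subset_goodSet (D : Design) : Icc D.lo D.hi ⊆ D.goodSet := by
  intro θ hθ
  have h1 := hθ.2 1
  have h3 := hθ.2 3
  have l1 := (D.lo_pos 1).trans_le (hθ.1 1)
  have l3 := (D.lo_pos 3).trans_le (hθ.1 3)
  have hi1 := D.hi_pos 1
  have hi3 := D.hi_pos 3
  have lo3 := D.lo_pos 3
  refine ⟨⟨mul_pos l1 D.τ₂_pos, ?_⟩, ⟨mul_pos l3 D.t₃_pos, ?_⟩⟩
  · calc θ 1 * D.τ₂ ≤ D.hi 1 * D.τ₂ := mul_le_mul_of_nonneg_right h1 D.τ₂_pos.le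
      _ = (1 - D.β) * Real.pi := by rw [τ₂]; field_simp
      _ < Real.pi := by nlinarith [D.β_pos, Real.pi_pos]
  · calc θ 3 * D.t₃ ≤ D.hi 3 * D.t₃ := mul_le_mul_of_nonneg_right h3 D.t₃_pos.le
      _ = D.hi 3 / (D.lo 3 + D.hi 3) * Real.pi := by rw [t₃]; ring
      _ < 1 * Real.pi := by
        gcongr
        rw [div_lt_one (by positivity)]
        linarith
      _ = Real.pi := one_mul _

theorem Θ_subset_Icc (D : Design) : D.Θ ⊆ Icc D.lo D.hi := fun _ hθ =>
  ⟨fun i => (hθ i trivial).1.le, fun i => (hθ i trivial).2.le⟩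

theorem Θ_subset_goodSet (D : Design) : D.Θ ⊆ D.goodSet :=
  D.Θ_subset_Icc.trans D.Icc_subset_goodSet

theorem isOpen_Θ (D : Design) : IsOpen D.Θ :=
  isOpen_set_pi finite_univ fun _ _ => isOpen_Ioo

theorem isOpen_goodSet (D : Design) : IsOpen D.goodSet :=
  (isOpen_Ioo.preimage (by fun_prop : Continuous fun θ : Fin 4 → ℝ => θ 1 * D.τ₂)).inter
    (isOpen_Ioo.preimage (by fun_prop : Continuous fun θ : Fin 4 → ℝ => θ 3 * D.t₃))

/-- The intermediate quantities of `F₀Inv` at a point of the image. -/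
theorem F₀_identities (h : θ ∈ D.goodSet) :
    -Real.log (D.F₀ θ 0) / D.t₁ = θ 0 ∧ 2 * D.F₀ θ 1 - 1 = Real.cos (θ 1 * D.τ₂) ∧
    ∀ t, (2 * pulsedProb t (θ 0 / 2 + 2 * θ 2) (θ 3) (θ 0) (θ 1 * D.τ₂) - 1
      + Real.cos (θ 1 * D.τ₂) * (1 - Real.exp (-(θ 0 * t)) * (1 + Real.cos (θ 1 * D.τ₂))))
        / (1 - Real.cos (θ 1 * D.τ₂) ^ 2)
      = Real.exp (-((θ 0 / 2 + 2 * θ 2) * t)) * Real.cos (θ 3 * t) := by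
  refine ⟨?_, ?_, fun t => ?_⟩
  · simp [F₀_eq, D.t₁_pos.ne']
  · simp [F₀_eq]; ring
  · have hs : Real.sin (θ 1 * D.τ₂) ≠ 0 := (Real.sin_pos_of_mem_Ioo h.1).ne'
    rw [← Real.sin_sq, pulsedProb]
    field_simp
    ring

/-- The double-angle formula eliminates `ω`; this is why the last two experiments relax during `t`
and `2t`. -/
theorem two_mul_sq_sub (a ν t : ℝ) :
    2 * (Real.exp (-(a * t)) * Real.cos (ν * t)) ^ 2
      - Real.exp (-(a * (2 * t))) * Real.cos (ν * (2 * t)) = Real.exp (-(a * t)) ^ 2 := by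
  rw [show -(a * (2 * t)) = -(a * t) + -(a * t) by ring, Real.exp_add,
    show ν * (2 * t) = 2 * (ν * t) by ring, Real.cos_two_mul]
  ring

theorem F₀Inv_F₀ (h : θ ∈ D.goodSet) : D.F₀Inv (D.F₀ θ) = θ := by
  obtain ⟨e0, e1, e2⟩ := F₀_identities h
  have eX := e2 D.t₃
  have eY := e2 (2 * D.t₃)
  have p2 : D.F₀ θ 2 = pulsedProb D.t₃ (θ 0 / 2 + 2 * θ 2) (θ 3) (θ 0) (θ 1 * D.τ₂) := by
    simp [F₀_eq]
  have p3 : D.F₀ θ 3 = pulsedProb (2 * D.t₃) (θ 0 / 2 + 2 * θ 2) (θ 3) (θ 0) (θ 1 * D.τ₂) := by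
    simp [F₀_eq]
  have ht := D.t₃_pos.ne'
  rw [F₀Inv]
  simp only [e0, e1, p2, p3, eX, eY, two_mul_sq_sub, Real.sqrt_sq (Real.exp_pos _).le,
    Real.log_pow, Real.log_exp]
  rw [mul_div_cancel_left₀ _ (Real.exp_pos _).ne', Real.arccos_cos h.1.1.le h.1.2.le,
    Real.arccos_cos h.2.1.le h.2.2.le]
  ext i
  fin_cases i <;> simp
  · exact mul_div_cancel_right₀ _ D.τ₂_pos.ne'
  · field_simp; ring
  · exact mul_div_cancel_right₀ _ ht

theorem cos_ne_of_mem_Ioo {x : ℝ} (hx : x ∈ Ioo 0 Real.pi) : Real.cos x ≠ -1 ∧ Real.cos x ≠ 1 := by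
  have h := Real.sin_pos_of_mem_Ioo hx
  constructor <;> intro hc <;> nlinarith [Real.sin_sq_add_cos_sq x]

/-- At an image point the arguments of the logarithms and of the square root are exponentials, the
denominator is `sin²(κτ₂) > 0`, and `arccos` is evaluated at cosines of angles in `(0, π)`, away
from `±1`. -/
theorem contDiffAt_F₀Inv (h : θ ∈ D.goodSet) : ContDiffAt ℝ ∞ D.F₀Inv (D.F₀ θ) := by
  obtain ⟨e0, e1, e2⟩ := F₀_identities h
  have eX := e2 D.t₃
  have eY := e2 (2 * D.t₃)
  have p2 : D.F₀ θ 2 = pulsedProb D.t₃ (θ 0 / 2 + 2 * θ 2) (θ 3) (θ 0) (θ 1 * D.τ₂) := by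
    simp [F₀_eq]
  have p3 : D.F₀ θ 3 = pulsedProb (2 * D.t₃) (θ 0 / 2 + 2 * θ 2) (θ 3) (θ 0) (θ 1 * D.τ₂) := by
    simp [F₀_eq]
  obtain ⟨c1, c2⟩ := cos_ne_of_mem_Ioo h.1
  obtain ⟨c3, c4⟩ := cos_ne_of_mem_Ioo h.2
  have hp0 : D.F₀ θ 0 ≠ 0 := by simp [F₀_eq]
  have hproj : ∀ i, ContDiffAt ℝ ∞ (fun p : Fin 4 → ℝ => p i) (D.F₀ θ) := fun i => by fun_prop
  have hγ : ContDiffAt ℝ ∞ (fun p : Fin 4 → ℝ => -Real.log (p 0) / D.t₁) (D.F₀ θ) :=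
    ((hproj 0).log hp0).neg.div_const _
  have hc : ContDiffAt ℝ ∞ (fun p : Fin 4 → ℝ => 2 * p 1 - 1) (D.F₀ θ) := by fun_prop
  have hXY : ∀ (j : Fin 4) (t : ℝ), ContDiffAt ℝ ∞ (fun p : Fin 4 → ℝ =>
      (2 * p j - 1 + (2 * p 1 - 1) * (1 - Real.exp (-(-Real.log (p 0) / D.t₁ * t))
        * (1 + (2 * p 1 - 1)))) / (1 - (2 * p 1 - 1) ^ 2)) (D.F₀ θ) := by
    intro j t
    refine ContDiffAt.div ?_ ?_ ?_
    · exact (((contDiffAt_const.mul (hproj j)).sub contDiffAt_const)).add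
        (hc.mul (contDiffAt_const.sub (((hγ.mul contDiffAt_const).neg.exp).mul
          (contDiffAt_const.add hc))))
    · exact contDiffAt_const.sub (hc.pow 2)
    · simp only [e1]
      rw [← Real.sin_sq]
      exact pow_ne_zero 2 (Real.sin_pos_of_mem_Ioo h.1).ne'
  have hX := hXY 2 D.t₃
  have hY := hXY 3 (2 * D.t₃)
  have hS := (contDiffAt_const (c := (2 : ℝ))).mul (hX.pow 2) |>.sub hY
  have hS0 := two_mul_sq_sub (θ 0 / 2 + 2 * θ 2) (θ 3) D.t₃
  have hpos := Real.exp_pos (-((θ 0 / 2 + 2 * θ 2) * D.t₃))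
  have hXS := hX.div (hS.sqrt (by
    simp only [e0, e1, p2, p3, eX, eY, hS0]; positivity)) (by
    simp only [e0, e1, p2, p3, eX, eY, hS0]; positivity)
  rw [contDiffAt_pi]
  intro i
  fin_cases i
  · exact hγ
  · refine ContDiffAt.div_const (ContDiffAt.comp (D.F₀ θ) (Real.contDiffAt_arccos ?_ ?_) hc) _
    · rw [e1]; exact c1
    · rw [e1]; exact c2
  · refine ((((hS.log ?_).neg.div_const _).sub (hγ.div_const 2)).div_const 2)
    simp only [e0, e1, p2, p3, eX, eY, hS0]; positivity
  · refine ContDiffAt.div_const (ContDiffAt.comp (D.F₀ θ) (Real.contDiffAt_arccos ?_ ?_) hXS) _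
    · simp only [Pi.div_apply, e0, e1, p2, p3, eX, eY, hS0, Real.sqrt_sq hpos.le,
        mul_div_cancel_left₀ _ hpos.ne']
      exact c3
    · simp only [Pi.div_apply, e0, e1, p2, p3, eX, eY, hS0, Real.sqrt_sq hpos.le,
        mul_div_cancel_left₀ _ hpos.ne']
      exact c4

theorem injOn_F₀ (D : Design) : InjOn D.F₀ D.Θ :=
  LeftInvOn.injOn fun _ hθ => F₀Inv_F₀ (D.Θ_subset_goodSet hθ)

/-- Here `(y, w)` are the last two Bloch coordinates after the relaxation. They lie strictly inside
the unit disc because `e s² + w² = 1 - e(1+c)²(1-e)`, and the final rotation cannot leave it. The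
hypothesis `γ ≤ 2a` gives `r² ≤ e`. -/
theorem pulsedProb_mem_Ioo {t a ν γ φ : ℝ} (ht : 0 < t) (hγ : 0 < γ) (ha : γ ≤ 2 * a)
    (hφ : φ ∈ Ioo 0 Real.pi) : pulsedProb t a ν γ φ ∈ Ioo 0 1 := by
  have hs := Real.sin_pos_of_mem_Ioo hφ
  obtain ⟨c1, -⟩ := cos_ne_of_mem_Ioo hφ
  have hsc := Real.sin_sq_add_cos_sq φ
  have hsc' := Real.sin_sq_add_cos_sq (ν * t)
  set e := Real.exp (-(γ * t)) with he
  set r := Real.exp (-(a * t))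
  have hr : r ^ 2 ≤ e := by
    rw [he, ← Real.exp_nat_mul]
    gcongr
    push_cast
    nlinarith
  have he0 : 0 < e := Real.exp_pos _
  have he1 : e < 1 := by rw [he, Real.exp_lt_one_iff]; nlinarith
  set s := Real.sin φ
  set c := Real.cos φ
  set y := r * Real.cos (ν * t) * s with hy
  set w := 1 - e * (1 + c) with hw
  have hcpos : 0 < 1 + c := by
    have := Real.neg_one_le_cos φ
    rcases lt_or_eq_of_le this with h | h
    · linarith
    · exact absurd h.symm c1
  have hy2 : y ^ 2 ≤ e * s ^ 2 := by
    have hcos : Real.cos (ν * t) ^ 2 ≤ 1 := Real.cos_sq_le_one _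
    calc y ^ 2 = r ^ 2 * Real.cos (ν * t) ^ 2 * s ^ 2 := by rw [hy]; ring
      _ ≤ e * 1 * s ^ 2 := by gcongr
      _ = e * s ^ 2 := by ring
  have hlt : y ^ 2 + w ^ 2 < 1 := by
    have : e * s ^ 2 + w ^ 2 = 1 - e * (1 + c) ^ 2 * (1 - e) := by
      rw [hw]; linear_combination e * hsc
    have : 0 < e * (1 + c) ^ 2 * (1 - e) := by
      have := sub_pos.2 he1
      positivity
    linarith
  have hcs : (y * s - c * w) ^ 2 < 1 := by
    -- Lagrange's identity, with `(s, c)` a unit vector.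
    have : (y * s - c * w) ^ 2 = (y ^ 2 + w ^ 2) - (y * c + s * w) ^ 2 := by
      linear_combination (y ^ 2 + w ^ 2) * hsc
    nlinarith [sq_nonneg (y * c + s * w)]
  have habs := abs_lt.1 ((sq_lt_one_iff_abs_lt_one _).1 hcs)
  have heq : pulsedProb t a ν γ φ = (1 + (y * s - c * w)) / 2 := by
    rw [pulsedProb]; ring
  rw [heq]
  constructor <;> linarith [habs.1, habs.2]

theorem F₀_mem_Ioo (hθ : θ ∈ D.Θ) (i : Fin 4) : D.F₀ θ i ∈ Ioo 0 1 := by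
  have h := D.Θ_subset_goodSet hθ
  have h0 := pos_of_mem_Θ hθ 0
  have h2 := pos_of_mem_Θ hθ 2
  have ht := D.t₃_pos
  rw [F₀_eq]
  fin_cases i
  · refine ⟨Real.exp_pos _, ?_⟩
    have := mul_pos h0 D.t₁_pos
    simpa using this
  · have hs := Real.sin_pos_of_mem_Ioo h.1
    have := Real.sin_sq_add_cos_sq (θ 1 * D.τ₂)
    constructor
    · simp; nlinarith
    · simp; nlinarith
  · exact pulsedProb_mem_Ioo ht h0 (by linarith) h.1
  · exact pulsedProb_mem_Ioo (by linarith) h0 (by linarith) h.1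

end Design

/-! ### Jacobians -/

theorem jac_mul_jac {f g : (Fin 4 → ℝ) → (Fin 4 → ℝ)} {x : Fin 4 → ℝ}
    (hg : DifferentiableAt ℝ g (f x)) (hf : DifferentiableAt ℝ f x) :
    jac g (f x) * jac f x = jac (g ∘ f) x := by
  rw [jac, jac, jac, fderiv_comp x hg hf, ← LinearMap.toMatrix'_mul]
  rfl

theorem jac_congr {f g : (Fin 4 → ℝ) → (Fin 4 → ℝ)} {x : Fin 4 → ℝ} (h : f =ᶠ[𝓝 x] g) :
    jac f x = jac g x := by
  rw [jac, jac, h.fderiv_eq]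

theorem jac_id (x : Fin 4 → ℝ) : jac id x = 1 := by
  rw [jac, fderiv_id]
  exact LinearMap.toMatrix'_id

theorem jac_mulVec (f : (Fin 4 → ℝ) → (Fin 4 → ℝ)) (x v : Fin 4 → ℝ) :
    jac f x *ᵥ v = fderiv ℝ f x v := by
  rw [jac, LinearMap.toMatrix'_mulVec]
  rfl

theorem _root_.ContDiffAt.continuousAt_jac {f : (Fin 4 → ℝ) → (Fin 4 → ℝ)} {x : Fin 4 → ℝ}
    (hf : ContDiffAt ℝ ∞ f x) : ContinuousAt (jac f) x := by
  have h : ContinuousAt (fderiv ℝ f) x := (hf.fderiv_right (m := 0) (by norm_cast)).continuousAt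
  refine continuousAt_pi.2 fun i => continuousAt_pi.2 fun j => ?_
  simp_rw [jac, LinearMap.toMatrix'_apply]
  exact continuousAt_pi.1 (h.clm_apply continuousAt_const) i

namespace Design

variable {D : Design} {θ : Fin 4 → ℝ}

theorem jac_F₀Inv_mul_jac_F₀ (h : θ ∈ D.goodSet) : jac D.F₀Inv (D.F₀ θ) * jac D.F₀ θ = 1 := by
  rw [jac_mul_jac ((contDiffAt_F₀Inv h).differentiableAt (by simp))
    (D.contDiff_F₀.contDiffAt.differentiableAt (by simp)), ← jac_id θ]
  refine jac_congr ?_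
  filter_upwards [D.isOpen_goodSet.mem_nhds h] with x hx
  exact F₀Inv_F₀ hx

theorem inv_jac_F₀ (h : θ ∈ D.goodSet) : (jac D.F₀ θ)⁻¹ = jac D.F₀Inv (D.F₀ θ) :=
  Matrix.inv_eq_left_inv (jac_F₀Inv_mul_jac_F₀ h)

/-- For square matrices the left inverse is two-sided, so the derivative is onto and `F₀` is open at
`θ`. -/
theorem map_nhds_F₀ (h : θ ∈ D.goodSet) : map D.F₀ (𝓝 θ) = 𝓝 (D.F₀ θ) := by
  have hd : HasStrictFDerivAt D.F₀ (fderiv ℝ D.F₀ θ) θ :=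
    D.contDiff_F₀.contDiffAt.hasStrictFDerivAt (by simp)
  refine hd.map_nhds_eq_of_surj ?_
  rw [LinearMap.range_eq_top]
  intro v
  refine ⟨jac D.F₀Inv (D.F₀ θ) *ᵥ v, ?_⟩
  have := mul_eq_one_comm.1 (jac_F₀Inv_mul_jac_F₀ h)
  change fderiv ℝ D.F₀ θ _ = v
  rw [← jac_mulVec, Matrix.mulVec_mulVec, this, Matrix.one_mulVec]

theorem isOpen_F₀_image (D : Design) : IsOpen (D.F₀ '' D.Θ) := by
  rw [isOpen_iff_mem_nhds]
  rintro _ ⟨θ, hθ, rfl⟩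
  rw [← map_nhds_F₀ (D.Θ_subset_goodSet hθ)]
  exact image_mem_map (D.isOpen_Θ.mem_nhds hθ)

variable {G : (Fin 4 → ℝ) → (Fin 4 → ℝ)}

theorem eqOn_F₀Inv (hG : LeftInvOn G D.F₀ D.Θ) : EqOn G D.F₀Inv (D.F₀ '' D.Θ) := by
  rintro _ ⟨θ, hθ, rfl⟩
  rw [hG hθ, F₀Inv_F₀ (D.Θ_subset_goodSet hθ)]

/-- Since the image is open, an arbitrary extension `G` has the germ of `F₀Inv` at each image point
and inherits its smoothness and Jacobian. -/
theorem eventuallyEq_F₀Inv (hG : LeftInvOn G D.F₀ D.Θ) (hθ : θ ∈ D.Θ) :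
    G =ᶠ[𝓝 (D.F₀ θ)] D.F₀Inv :=
  (eqOn_F₀Inv hG).eventuallyEq_of_mem (D.isOpen_F₀_image.mem_nhds (mem_image_of_mem _ hθ))

theorem contDiffAt_leftInv (hG : LeftInvOn G D.F₀ D.Θ) (hθ : θ ∈ D.Θ) :
    ContDiffAt ℝ ∞ G (D.F₀ θ) :=
  (contDiffAt_F₀Inv (D.Θ_subset_goodSet hθ)).congr_of_eventuallyEq (eventuallyEq_F₀Inv hG hθ)

theorem jac_leftInv (hG : LeftInvOn G D.F₀ D.Θ) (hθ : θ ∈ D.Θ) :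
    jac G (D.F₀ θ) = (jac D.F₀ θ)⁻¹ := by
  rw [jac_congr (eventuallyEq_F₀Inv hG hθ), inv_jac_F₀ (D.Θ_subset_goodSet hθ)]

theorem isUnit_jac_leftInv (hG : LeftInvOn G D.F₀ D.Θ) (hθ : θ ∈ D.Θ) :
    IsUnit (jac G (D.F₀ θ)) := by
  rw [jac_congr (eventuallyEq_F₀Inv hG hθ)]
  exact IsUnit.of_mul_eq_one _ (jac_F₀Inv_mul_jac_F₀ (D.Θ_subset_goodSet hθ))

theorem continuous_obsWidth (D : Design) : Continuous D.obsWidth := by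
  refine continuous_pi fun i => ?_
  fin_cases i <;> simp [obsWidth, C', C, normA, decay] <;> fun_prop

/-- Writing `δ = s · obsWidth θ` with `s ∈ [-1,1]⁴` replaces the `θ`-dependent box by a fixed
compact one. The inverse Jacobian extends continuously to the closed parameter box as the Jacobian
of `F₀Inv`. -/
theorem bddAbove_biasValues (D : Design) (i : Fin 4) : BddAbove (D.biasValues i) := by
  have hc : ContinuousOn (fun q : (Fin 4 → ℝ) × (Fin 4 → ℝ) =>
      (jac D.F₀Inv (D.F₀ q.1) *ᵥ (fun j => q.2 j * D.obsWidth q.1 j)) i)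
      (Icc D.lo D.hi ×ˢ Icc (-1) 1) := by
    intro q hq
    apply ContinuousAt.continuousWithinAt
    have h1 : ContinuousAt (fun q : (Fin 4 → ℝ) × (Fin 4 → ℝ) => jac D.F₀Inv (D.F₀ q.1)) q :=
      ContinuousAt.comp
        (f := fun q : (Fin 4 → ℝ) × (Fin 4 → ℝ) => D.F₀ q.1)
        (contDiffAt_F₀Inv (D.Icc_subset_goodSet hq.1)).continuousAt_jac
        (D.contDiff_F₀.continuous.comp continuous_fst).continuousAt
    have h2 : ∀ j, Continuous (fun q : (Fin 4 → ℝ) × (Fin 4 → ℝ) => q.2 j * D.obsWidth q.1 j) :=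
      fun j => ((continuous_apply j).comp continuous_snd).mul
        ((continuous_apply j).comp (D.continuous_obsWidth.comp continuous_fst))
    exact tendsto_finsetSum Finset.univ fun j _ =>
      (continuousAt_pi.1 (continuousAt_pi.1 h1 i) j).mul (h2 j).continuousAt
  have hK : IsCompact (Icc D.lo D.hi ×ˢ Icc (-1 : Fin 4 → ℝ) 1) := isCompact_Icc.prod isCompact_Icc
  refine (hK.bddAbove_image hc).mono ?_
  rintro x ⟨θ, hθ, δ, hδ, rfl⟩
  have hw : ∀ j, |δ j| ≤ D.obsWidth θ j := fun j => abs_le.2 ⟨hδ.1 j, hδ.2 j⟩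
  -- Where the width vanishes (coordinate 0 does), the quotient is `0` by convention and `δ j = 0`
  -- as well.
  refine ⟨(θ, fun j => δ j / D.obsWidth θ j), ⟨D.Θ_subset_Icc hθ, ?_⟩, ?_⟩
  · have : ∀ j, |δ j / D.obsWidth θ j| ≤ 1 := fun j => by
      rw [abs_div]
      exact div_le_one_of_le₀ ((hw j).trans (le_abs_self _)) (abs_nonneg _)
    exact ⟨fun j => (abs_le.1 (this j)).1, fun j => (abs_le.1 (this j)).2⟩
  · simp only
    rw [inv_jac_F₀ (D.Θ_subset_goodSet hθ)]
    congr 2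
    ext j
    rcases eq_or_ne (D.obsWidth θ j) 0 with h | h
    · have := hw j
      rw [h, abs_nonpos_iff] at this
      simp [h, this]
    · field_simp

end Design

/-! ### Taylor remainder and the bias box. -/

theorem _root_.ContDiffAt.isBigO_sub_fderiv {E F : Type*} [NormedAddCommGroup E] [NormedSpace ℝ E]
    [NormedAddCommGroup F] [NormedSpace ℝ F] {f : E → F} {x : E} (hf : ContDiffAt ℝ 2 f x) :
    (fun y => f y - f x - fderiv ℝ f x (y - x)) =O[𝓝 x] fun y => ‖y - x‖ ^ 2 := by
  obtain ⟨K, t, ht, hK⟩ := (hf.fderiv_right (m := 1) (by norm_num)).exists_lipschitzOnWith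
  have hd : ∀ᶠ y in 𝓝 x, DifferentiableAt ℝ f y := by
    filter_upwards [hf.eventually (by simp)] with y hy using hy.differentiableAt (by simp)
  obtain ⟨ε, hε, hball⟩ := Metric.mem_nhds_iff.1 (inter_mem ht hd)
  refine IsBigO.of_bound K ?_
  filter_upwards [Metric.ball_mem_nhds x hε] with y hy
  -- On the ball of radius `‖y - x‖` the derivative differs from that at `x` by at most `K‖y - x‖`;
  -- the mean value inequality there gives the square.
  have hsub : Metric.closedBall x ‖y - x‖ ⊆ Metric.ball x ε :=
    Metric.closedBall_subset_ball (by rwa [← dist_eq_norm])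
  have h := (convex_closedBall x ‖y - x‖).norm_image_sub_le_of_norm_fderiv_le' (𝕜 := ℝ) (f := f)
    (φ := fderiv ℝ f x) (C := K * ‖y - x‖)
    (fun z hz => (hball (hsub hz)).2)
    (fun z hz => by
      refine (hK.norm_sub_le (hball (hsub hz)).1 (mem_of_mem_nhds ht)).trans ?_
      gcongr
      rwa [← mem_closedBall_iff_norm])
    (Metric.mem_closedBall_self (norm_nonneg _)) (mem_closedBall_iff_norm.2 le_rfl)
  rw [norm_pow, norm_norm]
  exact h.trans_eq (by ring)

namespace Design

variable {D : Design} {θ : Fin 4 → ℝ} {G : (Fin 4 → ℝ) → (Fin 4 → ℝ)}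

theorem inv_jac_mulVec_mem_Δ (hθ : θ ∈ D.Θ) {δ : Fin 4 → ℝ}
    (hδ : δ ∈ Icc (-D.obsWidth θ) (D.obsWidth θ)) : (jac D.F₀ θ)⁻¹ *ᵥ δ ∈ D.Δ := by
  refine ⟨fun i => ?_, fun i => le_csSup (D.bddAbove_biasValues i) ⟨θ, hθ, δ, hδ, rfl⟩⟩
  -- The lower bound follows from the upper one because `Δ'(θ)` is symmetric.
  rw [neg_le]
  refine le_csSup (D.bddAbove_biasValues i)
    ⟨θ, hθ, -δ, ⟨neg_le_neg hδ.2, neg_le.1 hδ.1⟩, ?_⟩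
  rw [Matrix.mulVec_neg]
  rfl

/-- The remainder `u⁻¹ u^{-1/2}` in the estimate of the bias. -/
noncomputable def biasRemainder (u : ℝ) : ℝ := 1 / u * (1 / Real.sqrt u)

theorem tendsto_one_div_sqrt : Tendsto (fun u : ℝ => 1 / Real.sqrt u) atTop (𝓝 0) := by
  simpa [Function.comp_def] using tendsto_inv_atTop_zero.comp Real.tendsto_sqrt_atTop

theorem biasRemainder_isLittleO : biasRemainder =o[atTop] fun u => 1 / u := by
  have h := (isBigO_refl (fun u : ℝ => 1 / u) atTop).mul_isLittleO
    ((isLittleO_one_iff ℝ).2 tendsto_one_div_sqrt)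
  simp only [mul_one] at h
  exact h

/-- The Taylor remainder is `O(u⁻²)` with a constant depending on `θ`. The larger scale `u^{-3/2}`
absorbs any such constant for large `u`, so one remainder function serves every `θ`. -/
theorem sq_isLittleO_biasRemainder :
    (fun u : ℝ => (1 / u) ^ 2) =o[atTop] biasRemainder := by
  have h : (fun u : ℝ => biasRemainder u * (1 / Real.sqrt u)) =o[atTop]
      fun u : ℝ => biasRemainder u * 1 :=
    (isBigO_refl biasRemainder atTop).mul_isLittleO
      ((isLittleO_one_iff ℝ).2 tendsto_one_div_sqrt)
  refine (h.congr' ?_ (Eventually.of_forall fun u => mul_one _))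
  filter_upwards [eventually_gt_atTop 0] with u hu
  rw [biasRemainder, mul_assoc, ← sq, div_pow, Real.sq_sqrt hu.le]
  ring

theorem bias_mem (hG : LeftInvOn G D.F₀ D.Θ) (hθ : θ ∈ D.Θ) :
    ∀ᶠ u in atTop, θ - G (D.F u θ) ∈ (1 / u) • D.Δ + Metric.closedBall 0 (biasRemainder u) := by
  have hT := ((contDiffAt_leftInv hG hθ).of_le (by norm_cast)).isBigO_sub_fderiv
  have hv : (fun u => D.F u θ - D.F₀ θ) =O[atTop] fun u => 1 / u := by
    rw [isBigO_pi]
    intro j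
    refine IsBigO.of_bound (D.obsWidth θ j) ?_
    filter_upwards [eventually_gt_atTop 0] with u hu
    refine (abs_F_sub_F₀_le hθ hu j).trans ?_
    rw [Real.norm_of_nonneg (one_div_pos.2 hu).le, mul_comm]
  have hR := ((hT.comp_tendsto (D.tendsto_F hθ)).trans
    (hv.norm_left.pow 2)).trans_isLittleO sq_isLittleO_biasRemainder
  filter_upwards [hR.bound one_pos, eventually_gt_atTop 0] with u hu hu0
  set v := D.F u θ - D.F₀ θ with hvdef
  -- The vector `u • v` lies in `Δ'(θ)` by the pulse estimate; the first summand is the linear part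
  -- of `θ - G (D.F u θ)` and the second is minus the Taylor remainder.
  refine ⟨(1 / u) • ((jac D.F₀ θ)⁻¹ *ᵥ (-(u • v))),
    smul_mem_smul_set (inv_jac_mulVec_mem_Δ hθ ?_),
    -(G (D.F u θ) - G (D.F₀ θ) - fderiv ℝ G (D.F₀ θ) v), ?_, ?_⟩
  · have h : ∀ j, |u * v j| ≤ D.obsWidth θ j := fun j => by
      rw [abs_mul, abs_of_pos hu0]
      refine (mul_le_mul_of_nonneg_left (abs_F_sub_F₀_le hθ hu0 j) hu0.le).trans_eq ?_
      field_simp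
    exact ⟨fun j => neg_le_neg (abs_le.1 (h j)).2, fun j => neg_le.1 (abs_le.1 (h j)).1⟩
  · rw [mem_closedBall_zero_iff, norm_neg]
    refine hu.trans_eq ?_
    rw [one_mul, Real.norm_of_nonneg]
    exact mul_nonneg (one_div_pos.2 hu0).le (one_div_nonneg.2 (Real.sqrt_nonneg u))
  · rw [← jac_mulVec, jac_leftInv hG hθ, hG hθ, Matrix.mulVec_neg, Matrix.mulVec_smul, smul_neg,
      smul_smul, one_div_mul_cancel hu0.ne', one_smul]
    module

end Design

/-! ### Extended continuous mapping theorem -/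

section ContinuousMapping

variable {ι Ω E : Type*} [MeasurableSpace Ω] [NormedAddCommGroup E]
  [MeasurableSpace E] [BorelSpace E] {l : Filter ι} {Q : ι → Measure Ω}
  [∀ i, IsProbabilityMeasure (Q i)] {ν : Measure E} [IsProbabilityMeasure ν] {W : ι → Ω → E}

/-- Eventual tightness: the portmanteau bound on a closed tail set whose limiting mass is already
small. -/
theorem _root_.MeasureTheory.TendstoInDistribution.exists_norm_tail_lt (hW : TendstoInDistribution W l id Q ν)
    {ε : ℝ} (hε : 0 < ε) : ∃ R : ℝ, ∀ᶠ i in l, (Q i).real {a | R ≤ ‖W i a‖} < ε := by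
  have hmeas : ∀ n : ℕ, IsClosed {w : E | (n : ℝ) ≤ ‖w‖} := fun n =>
    isClosed_le continuous_const continuous_norm
  have hlim := tendsto_measure_iInter_atTop (μ := ν) (s := fun n : ℕ => {w : E | (n : ℝ) ≤ ‖w‖})
    (fun n => (hmeas n).measurableSet.nullMeasurableSet)
    (fun m n hmn w hw => show (m : ℝ) ≤ ‖w‖ from (Nat.cast_le.2 hmn).trans hw) ⟨0, measure_ne_top _ _⟩
  have hemp : ⋂ n : ℕ, {w : E | (n : ℝ) ≤ ‖w‖} = ∅ := by
    refine eq_empty_of_forall_notMem fun w hw => ?_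
    obtain ⟨n, hn⟩ := exists_nat_gt ‖w‖
    exact absurd (mem_iInter.1 hw n) (not_le.2 hn)
  rw [hemp, measure_empty] at hlim
  obtain ⟨n, hn⟩ := (hlim.eventually_lt_const (ENNReal.ofReal_pos.2 hε)).exists
  refine ⟨n, ?_⟩
  have hlimsup := ProbabilityMeasure.limsup_measure_closed_le_of_tendsto hW.tendsto (hmeas n)
  simp only [ProbabilityMeasure.coe_mk, Measure.map_id] at hlimsup
  filter_upwards [eventually_lt_of_limsup_lt (hlimsup.trans_lt hn)] with i hi
  rw [Measure.map_apply_of_aemeasurable (hW.forall_aemeasurable i) (hmeas n).measurableSet] at hi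
  rw [measureReal_def]
  exact (ENNReal.toReal_lt_toReal (measure_ne_top _ _) ENNReal.ofReal_ne_top).2 hi
    |>.trans_eq (ENNReal.toReal_ofReal hε.le)

/-- Joint convergence along `l ×ˢ 𝓝 w` is locally uniform convergence, hence uniform on closed balls
of a proper space; tightness controls the rest. Only the composites with `W i` need be measurable,
since `G` is arbitrary off the image. -/
theorem _root_.MeasureTheory.TendstoInDistribution.tendsto_integral_comp [ProperSpace E]
    (hW : TendstoInDistribution W l id Q ν)
    {f : ι → E → ℝ} {f₀ : E → ℝ} {M : ℝ} (hM : ∀ i w, |f i w| ≤ M) (hf₀ : Continuous f₀)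
    (hf : ∀ w, Tendsto (fun p : ι × E => f p.1 p.2) (l ×ˢ 𝓝 w) (𝓝 (f₀ w)))
    (hmeas : ∀ i, AEStronglyMeasurable (fun a => f i (W i a)) (Q i)) :
    Tendsto (fun i => ∫ a, f i (W i a) ∂(Q i)) l (𝓝 (∫ w, f₀ w ∂ν)) := by
  rcases l.eq_or_neBot with rfl | hne
  · exact tendsto_bot
  have hM₀ : ∀ w, ‖f₀ w‖ ≤ M := fun w =>
    le_of_tendsto ((hf w).comp (tendsto_id.prodMk (tendsto_const_nhds (x := w)))).norm
      (Eventually.of_forall fun i => hM i w)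
  have hMnn : 0 ≤ M := (norm_nonneg _).trans (hM₀ 0)
  have hmeas₀ : ∀ i, AEStronglyMeasurable (fun a => f₀ (W i a)) (Q i) := fun i =>
    (hf₀.measurable.comp_aemeasurable (hW.forall_aemeasurable i)).aestronglyMeasurable
  have hA : Tendsto (fun i => ∫ a, f₀ (W i a) ∂(Q i)) l (𝓝 (∫ w, f₀ w ∂ν)) := by
    have h := ProbabilityMeasure.tendsto_iff_forall_integral_tendsto.1 hW.tendsto
      (BoundedContinuousFunction.ofNormedAddCommGroup f₀ hf₀ M hM₀)
    simp only [ProbabilityMeasure.coe_mk, Measure.map_id,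
      BoundedContinuousFunction.coe_ofNormedAddCommGroup] at h
    refine h.congr fun i => ?_
    rw [integral_map (hW.forall_aemeasurable i) hf₀.measurable.aestronglyMeasurable]
  suffices hB : Tendsto (fun i => ∫ a, f i (W i a) ∂(Q i) - ∫ a, f₀ (W i a) ∂(Q i)) l (𝓝 0) by
    simpa using hB.add hA
  rw [Metric.tendsto_nhds]
  intro ε hε
  -- The tail costs at most `2M` times its probability; the added `1` covers `M = 0` and makes the
  -- final inequality strict.
  obtain ⟨R, hR⟩ := hW.exists_norm_tail_lt
    (ε := ε / (2 * (2 * M + 1))) (by positivity)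
  have hloc : TendstoLocallyUniformly f f₀ l := by
    rw [tendstoLocallyUniformly_iff_forall_tendsto]
    intro w
    rw [Metric.uniformity_eq_comap_nhds_zero, tendsto_comap_iff]
    have h := ((hf₀.tendsto w).comp (tendsto_snd (f := l) (g := 𝓝 w))).dist (hf w)
    rw [dist_self] at h
    exact h
  have hunif : ∀ᶠ i in l, ∀ w ∈ Metric.closedBall (0 : E) R, dist (f₀ w) (f i w) < ε / 2 :=
    Metric.tendstoUniformlyOn_iff.1
      ((tendstoLocallyUniformlyOn_iff_tendstoUniformlyOn_of_compact (isCompact_closedBall _ _)).1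
        hloc.tendstoLocallyUniformlyOn) (ε / 2) (by positivity)
  filter_upwards [hR, hunif] with i hi hu
  have hint : Integrable (fun a => f i (W i a)) (Q i) :=
    Integrable.of_bound (hmeas i) M (ae_of_all _ fun a => hM i _)
  have hint₀ : Integrable (fun a => f₀ (W i a)) (Q i) :=
    Integrable.of_bound (hmeas₀ i) M (ae_of_all _ fun a => hM₀ _)
  have hT : NullMeasurableSet {a | R ≤ ‖W i a‖} (Q i) :=
    (hW.forall_aemeasurable i).nullMeasurableSet_preimage
      (isClosed_le continuous_const continuous_norm : IsClosed {w : E | R ≤ ‖w‖}).measurableSet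
  have hintT : Integrable ({a | R ≤ ‖W i a‖}.indicator fun _ => 2 * M) (Q i) :=
    (integrable_const _).indicator₀ hT
  rw [dist_zero_right, ← integral_sub hint hint₀]
  calc ‖∫ a, f i (W i a) - f₀ (W i a) ∂(Q i)‖
      ≤ ∫ a, (ε / 2 + {a | R ≤ ‖W i a‖}.indicator (fun _ => 2 * M) a) ∂(Q i) := by
        refine norm_integral_le_of_norm_le ((integrable_const _).add hintT)
          (ae_of_all _ fun a => ?_)
        by_cases ha : R ≤ ‖W i a‖
        · rw [indicator_of_mem (by exact ha)]
          have := norm_sub_le (f i (W i a)) (f₀ (W i a))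
          have h1 : ‖f i (W i a)‖ ≤ M := hM i _
          have h2 := hM₀ (W i a)
          linarith
        · rw [indicator_of_notMem (by exact ha), add_zero, ← dist_eq_norm, dist_comm]
          exact (hu _ (by simpa using (not_le.1 ha).le)).le
    _ = ε / 2 + (Q i).real {a | R ≤ ‖W i a‖} * (2 * M) := by
        rw [integral_add (integrable_const _) hintT, integral_indicator₀ hT]
        simp
    _ ≤ ε / 2 + ε / (2 * (2 * M + 1)) * (2 * M) := by gcongr
    _ < ε / 2 + ε / (2 * (2 * M + 1)) * (2 * M + 1) := by
        gcongr
        linarith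
    _ = ε := by field_simp; ring

theorem _root_.MeasureTheory.TendstoInDistribution.comp_of_tendsto [ProperSpace E]
    (hW : TendstoInDistribution W l id Q ν)
    {F : Type*} [TopologicalSpace F] [MeasurableSpace F] [BorelSpace F]
    {g : ι → E → F} {g₀ : E → F} (hg₀ : Continuous g₀)
    (hg : ∀ w, Tendsto (fun p : ι × E => g p.1 p.2) (l ×ˢ 𝓝 w) (𝓝 (g₀ w)))
    (hmeas : ∀ i, AEMeasurable (fun a => g i (W i a)) (Q i)) :
    TendstoInDistribution (fun i a => g i (W i a)) l g₀ Q ν where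
  forall_aemeasurable := hmeas
  aemeasurable_limit := hg₀.measurable.aemeasurable
  tendsto := by
    refine ProbabilityMeasure.tendsto_iff_forall_integral_tendsto.2 fun φ => ?_
    simp only [ProbabilityMeasure.coe_mk]
    rw [integral_map hg₀.measurable.aemeasurable φ.continuous.measurable.aestronglyMeasurable]
    refine (hW.tendsto_integral_comp (f := fun i w => φ (g i w))
      (f₀ := fun w => φ (g₀ w)) (M := ‖φ‖) (fun i w => φ.norm_coe_le_norm _)
      (φ.continuous.comp hg₀) (fun w => (φ.continuous.tendsto _).comp (hg w))
      (fun i => (φ.continuous.measurable.comp_aemeasurable (hmeas i)).aestronglyMeasurable)).congr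
      fun i => ?_
    rw [integral_map (hmeas i) φ.continuous.measurable.aestronglyMeasurable]

end ContinuousMapping

/-! ### Characteristic functions of Bernoulli sums -/

theorem tendsto_one_add_pow_cexp {ι : Type*} {l : Filter ι} {n : ι → ℕ} {g : ι → ℂ} {t : ℂ}
    (hn : Tendsto n l atTop) (hg : Tendsto (fun i => n i * g i) l (𝓝 t)) :
    Tendsto (fun i => (1 + g i) ^ n i) l (𝓝 (Complex.exp t)) := by
  have hninv : Tendsto (fun i => ((n i : ℂ))⁻¹) l (𝓝 0) :=
    tendsto_inv_atTop_nhds_zero_nat.comp hn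
  have hn0 : ∀ᶠ i in l, n i ≠ 0 := hn.eventually_ne_atTop 0
  have hg0 : Tendsto g l (𝓝 0) := by
    have := hninv.mul hg
    rw [zero_mul] at this
    refine this.congr' (hn0.mono fun i hi => ?_)
    rw [inv_mul_cancel_left₀ (Nat.cast_ne_zero.2 hi)]
  have hsmall : ∀ᶠ i in l, ‖g i‖ < 1 / 2 := by
    have h := hg0.norm
    rw [norm_zero] at h
    exact h.eventually_lt_const (by norm_num)
  have hlog : Tendsto (fun i => n i * Complex.log (1 + g i)) l (𝓝 t) := by
    -- The logarithm differs from its linear part by at most `‖g‖²`, and `n‖g‖² = ‖n g‖ ‖g‖ → 0`.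
    have hdiff : Tendsto (fun i => n i * (Complex.log (1 + g i) - g i)) l (𝓝 0) := by
      have hb : Tendsto (fun i => ‖n i * g i‖ * ‖g i‖) l (𝓝 0) := by
        simpa using hg.norm.mul hg0.norm
      refine squeeze_zero_norm' (hsmall.mono fun i hi => ?_) hb
      rw [norm_mul, norm_mul, mul_assoc]
      refine mul_le_mul_of_nonneg_left ?_ (norm_nonneg _)
      refine (Complex.norm_log_one_add_sub_self_le (hi.trans (by norm_num))).trans ?_
      have : (1 - ‖g i‖)⁻¹ ≤ 2 := inv_le_of_inv_le₀ two_pos (by linarith)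
      nlinarith [sq_nonneg ‖g i‖]
    have := hdiff.add hg
    rw [zero_add] at this
    exact this.congr fun i => by ring
  refine ((Complex.continuous_exp.tendsto t).comp hlog).congr' (hsmall.mono fun i hi => ?_)
  have hne : 1 + g i ≠ 0 := by
    intro h
    rw [eq_neg_of_add_eq_zero_right h, norm_neg, norm_one] at hi
    norm_num at hi
  rw [Function.comp_apply, Complex.exp_nat_mul, Complex.exp_log hne]

/-- Characteristic function of a centred Bernoulli variable. -/
noncomputable def bernoulliChar (q s : ℝ) : ℂ :=
  q * Complex.exp ((s * (1 - q) : ℝ) * Complex.I) + (1 - q) * Complex.exp ((s * (0 - q) : ℝ) * Complex.I)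

theorem norm_cexp_mul_I_sub_le {y : ℝ} (hy : |y| ≤ 1) :
    ‖Complex.exp (y * Complex.I) - (1 + y * Complex.I - y ^ 2 / 2)‖ ≤ |y| ^ 3 := by
  have hn : ‖(y : ℂ) * Complex.I‖ = |y| := by simp
  have h := Complex.exp_bound (x := y * Complex.I) (hn.le.trans hy) (n := 3) (by norm_num)
  rw [hn] at h
  have hs : ∑ m ∈ Finset.range 3, ((y : ℂ) * Complex.I) ^ m / m.factorial
      = 1 + y * Complex.I - y ^ 2 / 2 := by
    simp [Finset.sum_range_succ, mul_pow, Nat.factorial]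
    ring
  rw [hs] at h
  refine h.trans ?_
  norm_num [Nat.factorial]
  nlinarith [pow_nonneg (abs_nonneg y) 3]

theorem norm_bernoulliChar_sub_le {q s : ℝ} (hq : q ∈ Icc 0 1) (hs : |s| ≤ 1) :
    ‖bernoulliChar q s - (1 - (s ^ 2 * (q * (1 - q)) / 2 : ℝ))‖ ≤ |s| ^ 3 := by
  have hq1 : 0 ≤ 1 - q := by linarith [hq.2]
  have b1 : |s * (1 - q)| ≤ |s| := by
    rw [abs_mul]
    exact mul_le_of_le_one_right (abs_nonneg s) (abs_le.2 ⟨by linarith, by linarith [hq.1]⟩)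
  have b2 : |s * (0 - q)| ≤ |s| := by
    rw [abs_mul]
    exact mul_le_of_le_one_right (abs_nonneg s) (abs_le.2 ⟨by linarith [hq.2], by linarith [hq.1]⟩)
  have e1 := (norm_cexp_mul_I_sub_le (b1.trans hs)).trans
    (pow_le_pow_left₀ (abs_nonneg _) b1 3)
  have e2 := (norm_cexp_mul_I_sub_le (b2.trans hs)).trans
    (pow_le_pow_left₀ (abs_nonneg _) b2 3)
  set r1 := Complex.exp ((s * (1 - q) : ℝ) * Complex.I) with hr1
  set r2 := Complex.exp ((s * (0 - q) : ℝ) * Complex.I) with hr2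
  -- Centring cancels the first-order terms, and the second-order ones add up to the variance
  -- `q(1-q)`.
  have key : bernoulliChar q s - (1 - (s ^ 2 * (q * (1 - q)) / 2 : ℝ))
      = q * (r1 - (1 + (s * (1 - q) : ℝ) * Complex.I - (s * (1 - q) : ℝ) ^ 2 / 2))
        + (1 - q : ℝ) * (r2 - (1 + (s * (0 - q) : ℝ) * Complex.I - (s * (0 - q) : ℝ) ^ 2 / 2)) := by
    rw [bernoulliChar, ← hr1, ← hr2]
    push_cast
    ring
  rw [key]
  refine (norm_add_le _ _).trans ?_
  rw [norm_mul, norm_mul, Complex.norm_real, Complex.norm_real, Real.norm_of_nonneg hq.1,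
    Real.norm_of_nonneg hq1]
  calc _ ≤ q * |s| ^ 3 + (1 - q) * |s| ^ 3 := by
        gcongr
        exact hq.1
    _ = |s| ^ 3 := by ring

/-- The cubic error bound is uniform in `q`, so the parameter may vary with the index, as in a
triangular array. -/
theorem tendsto_bernoulliChar_pow {ι : Type*} {l : Filter ι} {n : ι → ℕ} {q : ι → ℝ} {q₀ : ℝ}
    (hn : Tendsto n l atTop) (hq : Tendsto q l (𝓝 q₀)) (hq01 : ∀ᶠ i in l, q i ∈ Icc 0 1) (c : ℝ) :
    Tendsto (fun i => bernoulliChar (q i) (c / Real.sqrt (n i)) ^ n i) l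
      (𝓝 (Complex.exp ((-(c ^ 2 * (q₀ * (1 - q₀)) / 2) : ℝ)))) := by
  have hsqrt : Tendsto (fun i => Real.sqrt (n i)) l atTop :=
    Real.tendsto_sqrt_atTop.comp (tendsto_natCast_atTop_atTop.comp hn)
  have hs : Tendsto (fun i => c / Real.sqrt (n i)) l (𝓝 0) := hsqrt.const_div_atTop c
  have hn0 : ∀ᶠ i in l, 0 < n i := hn.eventually_gt_atTop 0
  have hmain : Tendsto (fun i => (n i : ℂ) * (bernoulliChar (q i) (c / Real.sqrt (n i)) - 1)) l
      (𝓝 ((-(c ^ 2 * (q₀ * (1 - q₀)) / 2) : ℝ) : ℂ)) := by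
    have h1 : Tendsto (fun i => ((-(c ^ 2 * (q i * (1 - q i)) / 2) : ℝ) : ℂ)) l
        (𝓝 ((-(c ^ 2 * (q₀ * (1 - q₀)) / 2) : ℝ) : ℂ)) :=
      (Complex.continuous_ofReal.tendsto _).comp
        (((hq.mul (hq.const_sub 1)).const_mul (c ^ 2)).div_const 2).neg
    have h2 : Tendsto (fun i => (n i : ℂ) * (bernoulliChar (q i) (c / Real.sqrt (n i))
        - (1 - ((c / Real.sqrt (n i)) ^ 2 * (q i * (1 - q i)) / 2 : ℝ)))) l (𝓝 0) := by
      have hb : Tendsto (fun i => c ^ 2 * |c / Real.sqrt (n i)|) l (𝓝 0) := by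
        simpa using hs.abs.const_mul (c ^ 2)
      refine squeeze_zero_norm' ?_ hb
      have hs1 : ∀ᶠ i in l, |c / Real.sqrt (n i)| < 1 := by
        simpa using hs.abs.eventually_lt_const (u := 1) (by simp)
      filter_upwards [hs1, hq01, hn0] with i h1 hqi hni
      rw [norm_mul, Complex.norm_natCast]
      refine (mul_le_mul_of_nonneg_left (norm_bernoulliChar_sub_le hqi h1.le)
        (Nat.cast_nonneg _)).trans_eq ?_
      have : (n i : ℝ) * |c / Real.sqrt (n i)| ^ 2 = c ^ 2 := by
        rw [sq_abs, div_pow, Real.sq_sqrt (Nat.cast_nonneg _)]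
        field_simp
      rw [pow_succ, ← mul_assoc, this]
    have h3 := h2.add h1
    rw [zero_add] at h3
    refine h3.congr' (hn0.mono fun i hi => ?_)
    have : ((c / Real.sqrt (n i)) ^ 2 * (q i * (1 - q i)) / 2 : ℝ)
        = c ^ 2 * (q i * (1 - q i)) / 2 / n i := by
      rw [div_pow, Real.sq_sqrt (Nat.cast_nonneg _)]
      ring
    rw [this]
    have hne : (n i : ℂ) ≠ 0 := Nat.cast_ne_zero.2 hi.ne'
    push_cast
    field_simp
    ring
  simpa using tendsto_one_add_pow_cexp hn hmain

/-! ### Central limit theorem for the empirical frequencies -/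

section EmpiricalFrequencies

variable {Ω : Type*} [MeasurableSpace Ω] {ξ : Fin 4 → ℕ → Ω → Bool}

/-- The frequencies factor through finitely many Booleans, so no measurability of `f` is needed;
this is what permits an arbitrary extension of the inverse. -/
theorem measurable_comp_empFreq (hξ : ∀ j k, Measurable (ξ j k)) {β : Type*} [MeasurableSpace β]
    (n : ℕ) (f : (Fin 4 → ℝ) → β) : Measurable fun w => f (empFreq ξ n w) := by
  let g : (Fin 4 → Fin n → Bool) → (Fin 4 → ℝ) := fun b j =>
    (∑ k : Fin n, if b j k then (1 : ℝ) else 0) / n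
  have h : (fun w => f (empFreq ξ n w)) = (f ∘ g) ∘ fun w j (k : Fin n) => ξ j k w := by
    ext1 w
    refine congrArg f (funext fun j => ?_)
    simp only [g, empFreq, Finset.sum_range]
  rw [h]
  exact (measurable_of_finite _).comp
    (measurable_pi_lambda _ fun j => measurable_pi_lambda _ fun k => hξ j k)

theorem empFreq_mem_Icc {Ω : Type*} (ξ : Fin 4 → ℕ → Ω → Bool) (n : ℕ) (w : Ω) :
    empFreq ξ n w ∈ Icc 0 1 := by
  have h0 : ∀ j, 0 ≤ ∑ k ∈ Finset.range n, if ξ j k w then (1 : ℝ) else 0 := fun j =>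
    Finset.sum_nonneg fun k _ => by split_ifs <;> norm_num
  have h1 : ∀ j, ∑ k ∈ Finset.range n, (if ξ j k w then (1 : ℝ) else 0) ≤ n := fun j => by
    refine (Finset.sum_le_card_nsmul _ _ 1 fun k _ => by split_ifs <;> norm_num).trans_eq ?_
    simp
  exact ⟨fun j => div_nonneg (h0 j) (Nat.cast_nonneg n),
    fun j => div_le_one_of_le₀ (h1 j) (Nat.cast_nonneg n)⟩

theorem integral_comp_bool (μ : Measure Ω) [IsProbabilityMeasure μ] {X : Ω → Bool}
    (hX : Measurable X) (f : Bool → ℂ) :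
    ∫ w, f (X w) ∂μ
      = μ.real {w | X w = true} * f true + (1 - μ.real {w | X w = true}) * f false := by
  have hm : MeasurableSet {w | X w = true} := hX (measurableSet_singleton true)
  have h : ∀ w, f (X w) = f false + {w | X w = true}.indicator (fun _ => f true - f false) w := by
    intro w
    by_cases hw : X w = true
    · rw [indicator_of_mem (by exact hw), hw]; ring
    · rw [indicator_of_notMem (by exact hw), Bool.eq_false_iff.2 hw]; ring
  simp_rw [h]
  rw [integral_add (integrable_const _) ((integrable_const _).indicator hm),
    integral_indicator_const _ hm]
  simp
  ring

/-- Normalised deviation of the empirical frequencies from `q`, with scales `S`. -/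
noncomputable def stdFreq (ξ : Fin 4 → ℕ → Ω → Bool) (S q : Fin 4 → ℝ) (n : ℕ) (w : Ω) :
    EuclideanSpace ℝ (Fin 4) :=
  WithLp.toLp 2 fun j => Real.sqrt n * (empFreq ξ n w j - q j) / S j

theorem measurable_stdFreq (hξ : ∀ j k, Measurable (ξ j k)) (S q : Fin 4 → ℝ) (n : ℕ) :
    Measurable (stdFreq ξ S q n) :=
  measurable_comp_empFreq hξ n fun p =>
    (WithLp.toLp 2 fun j => Real.sqrt n * (p j - q j) / S j : EuclideanSpace ℝ (Fin 4))

theorem charFun_map_stdFreq (μ : Measure Ω) [IsProbabilityMeasure μ]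
    (hξ : ∀ j k, Measurable (ξ j k)) (hind : iIndepFun (fun jk : Fin 4 × ℕ => ξ jk.1 jk.2) μ)
    {q : Fin 4 → ℝ} (hq : ∀ j k, μ.real {w | ξ j k w = true} = q j) (S : Fin 4 → ℝ) {n : ℕ}
    (hn : 0 < n) (t : EuclideanSpace ℝ (Fin 4)) :
    charFun (μ.map (stdFreq ξ S q n)) t
      = ∏ j, bernoulliChar (q j) (t j / S j / Real.sqrt n) ^ n := by
  let f : Fin 4 × Fin n → Bool → ℂ := fun jk b =>
    Complex.exp ((t jk.1 / S jk.1 / Real.sqrt n * ((if b then 1 else 0) - q jk.1) : ℝ) * Complex.I)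
  have hinner : ∀ w, Complex.exp (inner ℝ (stdFreq ξ S q n w) t * Complex.I)
      = ∏ jk : Fin 4 × Fin n, f jk (ξ jk.1 jk.2 w) := by
    intro w
    rw [← Complex.exp_sum, ← Finset.sum_mul, ← Complex.ofReal_sum]
    congr 3
    rw [Fintype.sum_prod_type, PiLp.inner_apply]
    refine Finset.sum_congr rfl fun j _ => ?_
    dsimp only
    rw [← Finset.mul_sum, Finset.sum_sub_distrib,
      ← Finset.sum_range (fun k => if ξ j k w then (1 : ℝ) else 0)]
    simp only [stdFreq, empFreq, Finset.sum_const, Finset.card_univ, Fintype.card_fin,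
      nsmul_eq_mul, RCLike.inner_apply, conj_trivial]
    have hn' : (n : ℝ) ≠ 0 := Nat.cast_ne_zero.2 hn.ne'
    have hs : Real.sqrt n ≠ 0 := (Real.sqrt_pos.2 (Nat.cast_pos.2 hn)).ne'
    have hss : Real.sqrt n ^ 2 = n := Real.sq_sqrt (Nat.cast_nonneg n)
    have key : Real.sqrt n / n = 1 / Real.sqrt n := by
      rw [div_eq_div_iff hn' hs, one_mul, ← sq, hss]
    set s := ∑ k ∈ Finset.range n, if ξ j k w then (1 : ℝ) else 0
    calc _ = t j / S j * (Real.sqrt n / n) * (s - n * q j) := by field_simp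
      _ = _ := by rw [key]; ring
  have hint : ∀ jk : Fin 4 × Fin n, ∫ w, f jk (ξ jk.1 jk.2 w) ∂μ
      = bernoulliChar (q jk.1) (t jk.1 / S jk.1 / Real.sqrt n) := by
    intro jk
    rw [integral_comp_bool μ (hξ _ _), hq, bernoulliChar]
    simp only [f, if_true, Bool.false_eq_true, if_false]
  have hind' : iIndepFun (fun jk : Fin 4 × Fin n => ξ jk.1 jk.2) μ :=
    hind.precomp (g := fun jk : Fin 4 × Fin n => (jk.1, (jk.2 : ℕ))) fun a b hab => by
      simp only [Prod.mk.injEq] at hab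
      exact Prod.ext hab.1 (Fin.ext hab.2)
  rw [charFun_apply, integral_map (measurable_stdFreq hξ S q n).aemeasurable
    (Measurable.aestronglyMeasurable (by fun_prop))]
  simp_rw [hinner]
  rw [hind'.integral_fun_prod_comp (fun jk => (hξ _ _).aemeasurable)
    (fun jk => (measurable_of_finite _).aestronglyMeasurable)]
  simp_rw [hint]
  rw [Fintype.prod_prod_type]
  simp

theorem tendstoInDistribution_stdFreq {ι : Type*} {l : Filter ι} [l.IsCountablyGenerated]
    {Q : ι → Measure Ω} [∀ i, IsProbabilityMeasure (Q i)] {q : ι → Fin 4 → ℝ} {n : ι → ℕ}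
    (hξ : ∀ j k, Measurable (ξ j k))
    (hind : ∀ᶠ i in l, iIndepFun (fun jk : Fin 4 × ℕ => ξ jk.1 jk.2) (Q i))
    (hq : ∀ᶠ i in l, ∀ j k, (Q i).real {w | ξ j k w = true} = q i j)
    {q₀ : Fin 4 → ℝ} (hlim : Tendsto q l (𝓝 q₀)) (hq₀ : ∀ j, q₀ j ∈ Ioo (0 : ℝ) 1)
    (hn : Tendsto n l atTop) :
    TendstoInDistribution
      (fun i => stdFreq ξ (fun j => Real.sqrt (q₀ j * (1 - q₀ j))) (q i) (n i)) l id Q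
      (stdGaussian (EuclideanSpace ℝ (Fin 4))) where
  forall_aemeasurable i := (measurable_stdFreq hξ _ _ _).aemeasurable
  tendsto := by
    -- Countable generation of the filter reduces to sequences, along which Lévy's continuity
    -- theorem applies.
    refine tendsto_of_subseq_tendsto fun x hx => ⟨id, ?_⟩
    refine ProbabilityMeasure.tendsto_iff_tendsto_charFun.2 fun t => ?_
    simp only [ProbabilityMeasure.coe_mk, Measure.map_id, id]
    have hcf : ∀ᶠ k in atTop, charFun ((Q (x k)).map (stdFreq ξ
          (fun j => Real.sqrt (q₀ j * (1 - q₀ j))) (q (x k)) (n (x k)))) t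
        = ∏ j, bernoulliChar (q (x k) j)
          (t j / Real.sqrt (q₀ j * (1 - q₀ j)) / Real.sqrt (n (x k))) ^ n (x k) := by
      filter_upwards [hx.eventually hind, hx.eventually hq,
        hx.eventually (hn.eventually_gt_atTop 0)] with k h1 h2 h3
      exact charFun_map_stdFreq _ hξ h1 h2 _ h3 t
    rw [tendsto_congr' hcf]
    have hprod := tendsto_finsetProd (Finset.univ : Finset (Fin 4)) fun j _ =>
      tendsto_bernoulliChar_pow (hn.comp hx) ((tendsto_pi_nhds.1 hlim j).comp hx)
        (by
          filter_upwards [hx.eventually hq] with k hk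
          rw [Function.comp_apply, ← hk j 0]
          exact ⟨measureReal_nonneg, measureReal_le_one⟩)
        (t j / Real.sqrt (q₀ j * (1 - q₀ j)))
    refine hprod.trans_eq ?_
    have hterm : ∀ j, -((t j / Real.sqrt (q₀ j * (1 - q₀ j))) ^ 2 * (q₀ j * (1 - q₀ j)) / 2)
        = -(t j ^ 2) / 2 := fun j => by
      have hv : 0 < q₀ j * (1 - q₀ j) := mul_pos (hq₀ j).1 (sub_pos.2 (hq₀ j).2)
      rw [div_pow, Real.sq_sqrt hv.le, div_mul_cancel₀ _ hv.ne', neg_div]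
    simp_rw [hterm]
    rw [charFun_stdGaussian, ← Complex.exp_sum, ← Complex.ofReal_sum, ← Finset.sum_div,
      Finset.sum_neg_distrib, ← EuclideanSpace.real_norm_sq_eq]
    push_cast
    rfl

end EmpiricalFrequencies

/-! ### The chi-square distribution and its quantiles -/

/-- Right continuity gives `≥`; absence of atoms gives left continuity and `≤`. The bounds `0 < q <
1` make the set bounded below and nonempty, so `sInf` is a true infimum. -/
theorem measureReal_Iic_sInf (μ : Measure ℝ) [IsProbabilityMeasure μ] [NullSingletonClass μ] {q : ℝ}
    (hq : q ∈ Ioo 0 1) : μ.real (Iic (sInf {x | q ≤ μ.real (Iic x)})) = q := by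
  simp_rw [← cdf_eq_real]
  set S := {x | q ≤ cdf μ x}
  have hne : S.Nonempty := ((tendsto_cdf_atTop μ).eventually_const_le hq.2).exists
  obtain ⟨a, ha⟩ := ((tendsto_cdf_atBot μ).eventually_lt_const hq.1).exists
  have hbdd : BddBelow S := ⟨a, fun x hx => by
    by_contra hxa
    exact absurd (hx.trans (monotone_cdf μ (not_le.1 hxa).le)) (not_le.2 ha)⟩
  apply le_antisymm
  · have hleft : Function.leftLim (cdf μ) (sInf S) = cdf μ (sInf S) := by
      have h := (cdf μ).measure_singleton (sInf S)
      rw [measure_cdf, measure_singleton, eq_comm, ENNReal.ofReal_eq_zero] at h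
      exact le_antisymm ((monotone_cdf μ).leftLim_le le_rfl) (by linarith)
    rw [← hleft]
    refine le_of_tendsto ((monotone_cdf μ).tendsto_leftLim (sInf S)) ?_
    filter_upwards [self_mem_nhdsWithin] with y hy
    exact (not_le.1 fun h => (notMem_of_lt_csInf hy hbdd) h).le
  · have hright : Tendsto (cdf μ) (𝓝[>] sInf S) (𝓝 (cdf μ (sInf S))) :=
      ((cdf μ).right_continuous _).mono_left (nhdsWithin_mono _ Ioi_subset_Ici_self)
    refine ge_of_tendsto hright ?_
    filter_upwards [self_mem_nhdsWithin] with y hy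
    obtain ⟨x, hx, hxy⟩ := exists_lt_of_csInf_lt hne hy
    exact le_trans hx (monotone_cdf μ hxy.le)

theorem chiSquare_eq_map_stdGaussian (k : ℕ) :
    chiSquare k = (stdGaussian (EuclideanSpace ℝ (Fin k))).map fun z => ∑ i, z i ^ 2 := by
  rw [← map_pi_eq_stdGaussian, Measure.map_map (by fun_prop) (by fun_prop), chiSquare]
  rfl

instance (k : ℕ) : IsProbabilityMeasure (chiSquare k) :=
  Measure.isProbabilityMeasure_map (Measurable.aemeasurable (by fun_prop))

/-- By Fubini: once all coordinates but one are fixed, at most two values of that one remain. At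
least one degree of freedom is needed, since `chiSquare 0` is a point mass. -/
instance (k : ℕ) : NullSingletonClass (chiSquare (k + 1)) where
  measure_singleton x := by
    have hmeas : Measurable fun z : Fin (k + 1) → ℝ => ∑ i, z i ^ 2 := by fun_prop
    rw [chiSquare, Measure.map_apply hmeas (measurableSet_singleton x)]
    have hmp := measurePreserving_piFinSuccAbove (fun _ : Fin (k + 1) => gaussianReal 0 1) 0
    have hs : MeasurableSet {p : ℝ × (Fin k → ℝ) | p.1 ^ 2 + ∑ i, p.2 i ^ 2 = x} :=
      measurableSet_eq_fun (by fun_prop) (by fun_prop)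
    have hpre : (fun z : Fin (k + 1) → ℝ => ∑ i, z i ^ 2) ⁻¹' {x}
        = MeasurableEquiv.piFinSuccAbove (fun _ : Fin (k + 1) => ℝ) 0 ⁻¹'
          {p : ℝ × (Fin k → ℝ) | p.1 ^ 2 + ∑ i, p.2 i ^ 2 = x} := by
      ext z
      simp [Fin.sum_univ_succ, MeasurableEquiv.piFinSuccAbove_apply, Fin.tail]
    have := nullSingletonClass_gaussianReal (μ := 0) (v := 1) one_ne_zero
    rw [hpre, hmp.measure_preimage hs.nullMeasurableSet, Measure.prod_apply_symm hs]
    refine lintegral_eq_zero_of_ae_eq_zero (ae_of_all _ fun y => ?_)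
    refine Set.Finite.measure_zero ((Set.toFinite
      {Real.sqrt (x - ∑ i, y i ^ 2), -Real.sqrt (x - ∑ i, y i ^ 2)}).subset fun t ht => ?_) _
    have ht' : t ^ 2 = x - ∑ i, y i ^ 2 := eq_sub_of_add_eq ht
    rw [← ht', Real.sqrt_sq_eq_abs]
    rcases abs_choice t with h | h <;> simp [h]

theorem chiSquare_Iic_chiSquareQuantile (k : ℕ) {q : ℝ} (hq : q ∈ Ioo 0 1) :
    chiSquare (k + 1) (Iic (chiSquareQuantile (k + 1) q)) = ENNReal.ofReal q := by
  have h := measureReal_Iic_sInf (chiSquare (k + 1)) hq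
  rw [chiSquareQuantile, ← ofReal_measureReal, h]

/-! ### Linear images of the standard Gaussian -/

theorem inner_toLp_mulVec {ι : Type*} [Fintype ι] (B : Matrix ι ι ℝ)
    (z t : EuclideanSpace ℝ ι) :
    inner ℝ (WithLp.toLp 2 (B *ᵥ z.ofLp)) t = inner ℝ z (WithLp.toLp 2 (Bᵀ *ᵥ t.ofLp)) := by
  simp only [EuclideanSpace.inner_eq_star_dotProduct, star_trivial]
  rw [Matrix.dotProduct_mulVec, ← Matrix.mulVec_transpose]

theorem map_mulVec_stdGaussian {ι : Type*} [Fintype ι] [DecidableEq ι] (B : Matrix ι ι ℝ) :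
    (stdGaussian (EuclideanSpace ℝ ι)).map (fun z => WithLp.toLp 2 (B *ᵥ z.ofLp))
      = multivariateGaussian 0 (B * Bᵀ) := by
  have hB : (B * Bᵀ).PosSemidef := by
    simpa using Matrix.posSemidef_self_mul_conjTranspose B
  have hcont : Continuous fun z : EuclideanSpace ℝ ι =>
      (WithLp.toLp 2 (B *ᵥ z.ofLp) : EuclideanSpace ℝ ι) :=
    (PiLp.continuous_toLp 2 _).comp
      (continuous_const.matrix_mulVec (PiLp.continuous_ofLp 2 _))
  have : IsProbabilityMeasure ((stdGaussian (EuclideanSpace ℝ ι)).map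
      (fun z => (WithLp.toLp 2 (B *ᵥ z.ofLp) : EuclideanSpace ℝ ι))) :=
    Measure.isProbabilityMeasure_map hcont.measurable.aemeasurable
  apply Measure.ext_of_charFun
  ext t
  rw [charFun_apply, integral_map hcont.measurable.aemeasurable
    (Measurable.aestronglyMeasurable (by fun_prop))]
  simp_rw [inner_toLp_mulVec]
  have hsq : t.ofLp ⬝ᵥ (B * Bᵀ) *ᵥ t.ofLp
      = ‖(WithLp.toLp 2 (Bᵀ *ᵥ t.ofLp) : EuclideanSpace ℝ ι)‖ ^ 2 := by
    rw [EuclideanSpace.real_norm_sq_eq, ← Matrix.mulVec_mulVec, Matrix.dotProduct_mulVec,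
      ← Matrix.mulVec_transpose]
    simp [dotProduct, sq]
  rw [← charFun_apply, charFun_stdGaussian, charFun_multivariateGaussian hB, hsq,
    inner_zero_right]
  push_cast
  ring_nf

theorem _root_.MeasureTheory.TendstoInDistribution.of_map_eq {ι Ω Ω' Ω'' E : Type*} [MeasurableSpace Ω]
    [MeasurableSpace Ω'] [MeasurableSpace Ω''] [TopologicalSpace E] [MeasurableSpace E]
    [OpensMeasurableSpace E] {l : Filter ι} {Q : ι → Measure Ω} [∀ i, IsProbabilityMeasure (Q i)]
    {μ : Measure Ω'} [IsProbabilityMeasure μ] {ν : Measure Ω''} [IsProbabilityMeasure ν]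
    {X : ι → Ω → E} {Z : Ω' → E} {Z' : Ω'' → E} (h : TendstoInDistribution X l Z Q μ)
    (hZ' : AEMeasurable Z' ν) (hmap : μ.map Z = ν.map Z') :
    TendstoInDistribution X l Z' Q ν where
  forall_aemeasurable := h.forall_aemeasurable
  aemeasurable_limit := hZ'
  tendsto := by
    have heq : (⟨μ.map Z, Measure.isProbabilityMeasure_map h.aemeasurable_limit⟩ :
        ProbabilityMeasure E) = ⟨ν.map Z', Measure.isProbabilityMeasure_map hZ'⟩ :=
      Subtype.ext hmap
    exact heq ▸ h.tendsto

/-! ### Delta method -/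

/-- The frequencies whose normalised deviation from `q` is `z`. -/
noncomputable def freqOf (S q : Fin 4 → ℝ) (n : ℕ) (z : EuclideanSpace ℝ (Fin 4)) : Fin 4 → ℝ :=
  if n = 0 then 0 else fun j => q j + S j * z j / Real.sqrt n

/-- Turns each statistic of the frequencies into a function of the asymptotically Gaussian variable.
For `n = 0` both sides vanish, the frequency being a division by zero. -/
theorem freqOf_stdFreq {Ω : Type*} (ξ : Fin 4 → ℕ → Ω → Bool) {S : Fin 4 → ℝ}
    (hS : ∀ j, S j ≠ 0) (q : Fin 4 → ℝ) (n : ℕ) (w : Ω) :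
    freqOf S q n (stdFreq ξ S q n w) = empFreq ξ n w := by
  rw [freqOf]
  split_ifs with hn
  · subst hn
    ext j
    simp [empFreq]
  · have hs : Real.sqrt n ≠ 0 := (Real.sqrt_pos.2 (Nat.cast_pos.2 (Nat.pos_of_ne_zero hn))).ne'
    ext j
    have := hS j
    simp only [stdFreq]
    field_simp
    ring

section DeltaMethod

variable {ι : Type*} {l : Filter ι} {n : ι → ℕ} {q : ι → Fin 4 → ℝ} {q₀ : Fin 4 → ℝ}
  {S : Fin 4 → ℝ}

theorem tendsto_sqrt_smul_freqOf_sub (hn : Tendsto n l atTop) (z : EuclideanSpace ℝ (Fin 4)) :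
    Tendsto (fun p : ι × EuclideanSpace ℝ (Fin 4) =>
      Real.sqrt (n p.1) • (freqOf S (q p.1) (n p.1) p.2 - q p.1)) (l ×ˢ 𝓝 z)
      (𝓝 fun j => S j * z j) := by
  have hc : Continuous fun z : EuclideanSpace ℝ (Fin 4) => fun j => S j * z j := by fun_prop
  refine ((hc.tendsto z).comp tendsto_snd).congr' ?_
  filter_upwards [tendsto_fst.eventually (hn.eventually_gt_atTop 0)] with p hp
  have hs : Real.sqrt (n p.1) ≠ 0 := (Real.sqrt_pos.2 (Nat.cast_pos.2 hp)).ne'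
  ext j
  simp only [Function.comp_apply, freqOf, if_neg hp.ne', Pi.smul_apply, Pi.sub_apply, smul_eq_mul]
  field_simp
  ring

theorem tendsto_freqOf (hn : Tendsto n l atTop) (hq : Tendsto q l (𝓝 q₀))
    (z : EuclideanSpace ℝ (Fin 4)) :
    Tendsto (fun p : ι × EuclideanSpace ℝ (Fin 4) => freqOf S (q p.1) (n p.1) p.2) (l ×ˢ 𝓝 z)
      (𝓝 q₀) := by
  have hinv : Tendsto (fun p : ι × EuclideanSpace ℝ (Fin 4) => (Real.sqrt (n p.1))⁻¹) (l ×ˢ 𝓝 z)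
      (𝓝 0) :=
    (tendsto_inv_atTop_zero.comp
      (Real.tendsto_sqrt_atTop.comp (tendsto_natCast_atTop_atTop.comp hn))).comp tendsto_fst
  have h := (hinv.smul (tendsto_sqrt_smul_freqOf_sub (S := S) (q := q) hn z)).add
    (hq.comp tendsto_fst)
  rw [zero_smul, zero_add] at h
  refine h.congr' ?_
  filter_upwards [tendsto_fst.eventually (hn.eventually_gt_atTop 0)] with p hp
  have hs : Real.sqrt (n p.1) ≠ 0 := (Real.sqrt_pos.2 (Nat.cast_pos.2 hp)).ne'
  rw [inv_smul_smul₀ hs, Function.comp_apply, sub_add_cancel]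

/-- Strict differentiability is required because both points move: the centre `q` depends on `u`.
The error is `o` of the frequency deviation, which is `O(1/√n)`. -/
theorem tendsto_sqrt_smul_comp_freqOf_sub (hn : Tendsto n l atTop) (hq : Tendsto q l (𝓝 q₀))
    {G : (Fin 4 → ℝ) → (Fin 4 → ℝ)} {G' : (Fin 4 → ℝ) →L[ℝ] (Fin 4 → ℝ)}
    (hG : HasStrictFDerivAt G G' q₀) (z : EuclideanSpace ℝ (Fin 4)) :
    Tendsto (fun p : ι × EuclideanSpace ℝ (Fin 4) =>
      Real.sqrt (n p.1) • (G (freqOf S (q p.1) (n p.1) p.2) - G (q p.1))) (l ×ˢ 𝓝 z)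
      (𝓝 (G' fun j => S j * z j)) := by
  have hs := tendsto_sqrt_smul_freqOf_sub (S := S) (q := q) hn z
  have hpair : Tendsto (fun p : ι × EuclideanSpace ℝ (Fin 4) =>
      (freqOf S (q p.1) (n p.1) p.2, q p.1)) (l ×ˢ 𝓝 z) (𝓝 (q₀, q₀)) :=
    (tendsto_freqOf hn hq z).prodMk_nhds (hq.comp tendsto_fst)
  have hlo := (isBigO_refl (fun p : ι × EuclideanSpace ℝ (Fin 4) => Real.sqrt (n p.1))
    (l ×ˢ 𝓝 z)).smul_isLittleO (hG.isLittleO.comp_tendsto hpair)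
  have hone := (hlo.trans_isBigO (hs.isBigO_one ℝ))
  rw [isLittleO_one_iff] at hone
  have h := hone.add ((G'.continuous.tendsto _).comp hs)
  rw [zero_add] at h
  refine h.congr fun p => ?_
  simp only [Function.comp_apply, smul_sub, map_smul, map_sub]
  abel

end DeltaMethod

theorem diagonal_mul_one_sub_diagonal {p S : Fin 4 → ℝ} (hS : ∀ j, S j ^ 2 = p j * (1 - p j)) :
    Matrix.diagonal p * (1 - Matrix.diagonal p) = Matrix.diagonal S * Matrix.diagonal S := by
  rw [← Matrix.diagonal_one, Matrix.diagonal_sub, Matrix.diagonal_mul_diagonal,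
    Matrix.diagonal_mul_diagonal]
  congr 1
  ext j
  rw [← sq, hS]

theorem deltaCov_eq_mul_transpose (G : (Fin 4 → ℝ) → (Fin 4 → ℝ)) {p S : Fin 4 → ℝ}
    (hS : ∀ j, S j ^ 2 = p j * (1 - p j)) :
    deltaCov G p = jac G p * Matrix.diagonal S * (jac G p * Matrix.diagonal S)ᵀ := by
  rw [deltaCov, diagonal_mul_one_sub_diagonal hS, Matrix.transpose_mul, Matrix.diagonal_transpose]
  simp only [Matrix.mul_assoc]

theorem isUnit_jac_mul_diagonal {G : (Fin 4 → ℝ) → (Fin 4 → ℝ)} {p S : Fin 4 → ℝ}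
    (hJ : IsUnit (jac G p)) (hS : ∀ j, S j ≠ 0) : IsUnit (jac G p * Matrix.diagonal S) :=
  hJ.mul (Matrix.isUnit_diagonal.2 (Pi.isUnit_iff.2 fun j => (hS j).isUnit))

/-- With `Σ = B Bᵀ`, this whitening identity makes the limiting quadratic form exactly chi-square.
-/
theorem mulVec_dotProduct_inv_mul_transpose {B : Matrix (Fin 4) (Fin 4) ℝ} (hB : IsUnit B)
    (z : Fin 4 → ℝ) : (B *ᵥ z) ⬝ᵥ ((B * Bᵀ)⁻¹ *ᵥ (B *ᵥ z)) = z ⬝ᵥ z := by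
  have hdet : IsUnit B.det := (Matrix.isUnit_iff_isUnit_det B).1 hB
  have hdetT : IsUnit Bᵀ.det := by rwa [Matrix.det_transpose]
  rw [Matrix.mul_inv_rev, Matrix.mulVec_mulVec, Matrix.mul_assoc, Matrix.nonsing_inv_mul B hdet,
    Matrix.mul_one, Matrix.dotProduct_mulVec, ← Matrix.mulVec_transpose, Matrix.mulVec_mulVec,
    ← Matrix.transpose_nonsing_inv, Matrix.transpose_transpose, Matrix.nonsing_inv_mul B hdet,
    Matrix.one_mulVec]

open scoped Matrix.Norms.Operator in
theorem continuousAt_inv_deltaCov {G : (Fin 4 → ℝ) → (Fin 4 → ℝ)} {p : Fin 4 → ℝ}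
    (hG : ContDiffAt ℝ ∞ G p) (hu : IsUnit (deltaCov G p)) :
    ContinuousAt (fun p => (deltaCov G p)⁻¹) p := by
  have hd : ContinuousAt (fun p : Fin 4 → ℝ => Matrix.diagonal p) p :=
    (Continuous.matrix_diagonal continuous_id).continuousAt
  have hJ := hG.continuousAt_jac
  have hJT : ContinuousAt (fun p => (jac G p)ᵀ) p :=
    (Continuous.matrix_transpose continuous_id).continuousAt.comp hJ
  have hc : ContinuousAt (deltaCov G) p :=
    (hJ.mul (hd.mul (continuousAt_const.sub hd))).mul hJT
  simp_rw [Matrix.nonsing_inv_eq_ringInverse]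
  obtain ⟨v, hv⟩ := hu
  -- The operator norm makes the matrices a complete normed ring, where inversion is continuous at
  -- units.
  have := NormedRing.inverse_continuousAt v
  rw [hv] at this
  exact ContinuousAt.comp this hc

theorem mem_singleton_add_smul_ellipsoid_iff {G : (Fin 4 → ℝ) → (Fin 4 → ℝ)} {α s : ℝ}
    (hs : 0 < s) {p m : Fin 4 → ℝ} :
    m ∈ {G p} + (1 / s) • ellipsoid G α p ↔
      (s • (G p - m)) ⬝ᵥ ((deltaCov G p)⁻¹ *ᵥ (s • (G p - m)))
        ≤ chiSquareQuantile 4 (1 - α) := by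
  have hneg : ∀ e : Fin 4 → ℝ, -e ∈ ellipsoid G α p ↔ e ∈ ellipsoid G α p := fun e => by
    simp [ellipsoid, Matrix.mulVec_neg]
  have h1 : m ∈ {G p} + (1 / s) • ellipsoid G α p ↔ s • (m - G p) ∈ ellipsoid G α p := by
    rw [singleton_add, image_add_left, mem_preimage, one_div,
      mem_inv_smul_set_iff₀ hs.ne', neg_add_eq_sub]
  rw [h1, ← hneg, ← smul_neg, neg_sub]
  rfl

/-! ### Asymptotics of the estimator -/

namespace IsExperiment

variable {D : Design} {Ω : Type*} [MeasurableSpace Ω] {P : (Fin 4 → ℝ) → ℝ → Measure Ω}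
  [∀ θ u, IsProbabilityMeasure (P θ u)] {ξ : Fin 4 → ℕ → Ω → Bool} {θ : Fin 4 → ℝ}

theorem tendsto_F_snd (hθ : θ ∈ D.Θ) :
    Tendsto (fun x : ℕ × ℝ => D.F x.2 θ) (atTop ×ˢ atTop) (𝓝 (D.F₀ θ)) :=
  (D.tendsto_F hθ).comp tendsto_snd

/-- Asymptotic standard deviations of the outcomes of the four experiments. -/
noncomputable def stdDev (D : Design) (θ : Fin 4 → ℝ) (j : Fin 4) : ℝ :=
  Real.sqrt (D.F₀ θ j * (1 - D.F₀ θ j))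

theorem stdDev_sq (hθ : θ ∈ D.Θ) (j : Fin 4) :
    stdDev D θ j ^ 2 = D.F₀ θ j * (1 - D.F₀ θ j) :=
  Real.sq_sqrt (mul_nonneg (Design.F₀_mem_Ioo hθ j).1.le
    (sub_nonneg.2 (Design.F₀_mem_Ioo hθ j).2.le))

theorem stdDev_ne_zero (hθ : θ ∈ D.Θ) (j : Fin 4) : stdDev D θ j ≠ 0 :=
  (Real.sqrt_pos.2 (mul_pos (Design.F₀_mem_Ioo hθ j).1
    (sub_pos.2 (Design.F₀_mem_Ioo hθ j).2))).ne'

theorem tendsto_stdFreq (hξ : IsExperiment D P ξ) (hθ : θ ∈ D.Θ) :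
    TendstoInDistribution
      (fun x : ℕ × ℝ => stdFreq ξ (stdDev D θ) (D.F x.2 θ) x.1) (atTop ×ˢ atTop) id
      (fun x => P θ x.2) (stdGaussian (EuclideanSpace ℝ (Fin 4))) := by
  have hu : ∀ᶠ x : ℕ × ℝ in atTop ×ˢ atTop, 0 < x.2 :=
    tendsto_snd.eventually (eventually_gt_atTop 0)
  exact tendstoInDistribution_stdFreq hξ.measurable (hu.mono fun x hx => hξ.indep θ hθ x.2 hx)
    (hu.mono fun x hx => hξ.bernoulli θ hθ x.2 hx) (tendsto_F_snd hθ) (Design.F₀_mem_Ioo hθ)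
    tendsto_fst

/-- A law of large numbers: the composed functions converge to a constant, so the Gaussian limit
integrates out. -/
theorem tendsto_integral_real (hξ : IsExperiment D P ξ) (hθ : θ ∈ D.Θ) {f : (Fin 4 → ℝ) → ℝ}
    {M : ℝ} (hM : ∀ p, |f p| ≤ M) (hf : ContinuousAt f (D.F₀ θ)) :
    Tendsto (fun x : ℕ × ℝ => ∫ w, f (empFreq ξ x.1 w) ∂(P θ x.2)) (atTop ×ˢ atTop)
      (𝓝 (f (D.F₀ θ))) := by
  have h := (hξ.tendsto_stdFreq hθ).tendsto_integral_comp
    (f := fun x z => f (freqOf (stdDev D θ) (D.F x.2 θ) x.1 z)) (f₀ := fun _ => f (D.F₀ θ))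
    (fun x z => hM _) continuous_const
    (fun z => hf.tendsto.comp (tendsto_freqOf tendsto_fst (tendsto_F_snd hθ) z))
    (fun x => by
      simp_rw [freqOf_stdFreq ξ (stdDev_ne_zero hθ)]
      exact (measurable_comp_empFreq hξ.measurable x.1 f).aestronglyMeasurable)
  simp_rw [freqOf_stdFreq ξ (stdDev_ne_zero hθ)] at h
  simpa using h

theorem tendsto_integral (hξ : IsExperiment D P ξ) (hθ : θ ∈ D.Θ)
    {f : (Fin 4 → ℝ) → (Fin 4 → ℝ)} {M : ℝ} (hM : ∀ p, ‖f p‖ ≤ M)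
    (hf : ContinuousAt f (D.F₀ θ)) :
    Tendsto (fun x : ℕ × ℝ => ∫ w, f (empFreq ξ x.1 w) ∂(P θ x.2)) (atTop ×ˢ atTop)
      (𝓝 (f (D.F₀ θ))) := by
  rw [tendsto_pi_nhds]
  intro i
  have hMi : ∀ p, |f p i| ≤ M := fun p => (norm_le_pi_norm (f p) i).trans (hM p)
  refine (hξ.tendsto_integral_real hθ hMi (continuousAt_pi.1 hf i)).congr fun x => ?_
  rw [eval_integral fun i => ?_]
  exact Integrable.of_bound
    (measurable_comp_empFreq hξ.measurable x.1 fun p => f p i).aestronglyMeasurable M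
    (ae_of_all _ fun w => (norm_le_pi_norm (f _) i).trans (hM _))

theorem tendsto_measure_mem (hξ : IsExperiment D P ξ) (hθ : θ ∈ D.Θ) {A : Set (Fin 4 → ℝ)}
    (hA : A ∈ 𝓝 (D.F₀ θ)) :
    Tendsto (fun x : ℕ × ℝ => P θ x.2 {w | empFreq ξ x.1 w ∈ A}) (atTop ×ˢ atTop) (𝓝 1) := by
  have hA1 : A.indicator (fun _ => (1 : ℝ)) =ᶠ[𝓝 (D.F₀ θ)] fun _ => 1 :=
    mem_of_superset hA fun p hp => indicator_of_mem hp _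
  have h := hξ.tendsto_integral_real hθ (f := A.indicator fun _ => 1) (M := 1)
    (fun p => by
      by_cases hp : p ∈ A
      · simp [hp]
      · simp [hp])
    (continuousAt_const.congr hA1.symm)
  rw [hA1.eq_of_nhds] at h
  have h2 := ENNReal.tendsto_ofReal h
  rw [ENNReal.ofReal_one] at h2
  refine h2.congr fun x => ?_
  have hm : MeasurableSet {w | empFreq ξ x.1 w ∈ A} :=
    (measurable_comp_empFreq hξ.measurable x.1 fun p => p ∈ A).setOf
  rw [← ofReal_measureReal, ← integral_indicator_one hm]
  rfl

theorem tendsto_setIntegral (hξ : IsExperiment D P ξ) (hθ : θ ∈ D.Θ) {A : Set (Fin 4 → ℝ)}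
    (hA : A ∈ 𝓝 (D.F₀ θ)) {G : (Fin 4 → ℝ) → (Fin 4 → ℝ)} (hb : Bornology.IsBounded (G '' A))
    (hG : ContinuousAt G (D.F₀ θ)) :
    Tendsto (fun x : ℕ × ℝ => ∫ w in {w | empFreq ξ x.1 w ∈ A}, G (empFreq ξ x.1 w) ∂(P θ x.2))
      (atTop ×ˢ atTop) (𝓝 (G (D.F₀ θ))) := by
  obtain ⟨M, hM⟩ := hb.exists_norm_le
  have hM0 : 0 ≤ M := (norm_nonneg _).trans (hM _ (mem_image_of_mem G (mem_of_mem_nhds hA)))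
  have hAG : A.indicator G =ᶠ[𝓝 (D.F₀ θ)] G := mem_of_superset hA fun p hp => indicator_of_mem hp _
  have h := hξ.tendsto_integral hθ (f := A.indicator G) (M := M)
    (fun p => by
      by_cases hp : p ∈ A
      · rw [indicator_of_mem hp]; exact hM _ (mem_image_of_mem G hp)
      · rwa [indicator_of_notMem hp, norm_zero])
    (hG.congr hAG.symm)
  rw [hAG.eq_of_nhds] at h
  refine h.congr fun x => ?_
  have hm : MeasurableSet {w | empFreq ξ x.1 w ∈ A} :=
    (measurable_comp_empFreq hξ.measurable x.1 fun p => p ∈ A).setOf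
  rw [← integral_indicator hm]
  rfl

variable {G : (Fin 4 → ℝ) → (Fin 4 → ℝ)}

theorem F₀_image_mem_nhds (hθ : θ ∈ D.Θ) : D.F₀ '' D.Θ ∈ 𝓝 (D.F₀ θ) :=
  D.isOpen_F₀_image.mem_nhds (mem_image_of_mem _ hθ)

theorem tendsto_condExpectation (hξ : IsExperiment D P ξ) (hG : LeftInvOn G D.F₀ D.Θ)
    (hθ : θ ∈ D.Θ) :
    Tendsto (fun x : ℕ × ℝ => ∫ w, G (empFreq ξ x.1 w)
        ∂((P θ x.2)[|{w | empFreq ξ x.1 w ∈ D.F₀ '' D.Θ}])) (atTop ×ˢ atTop) (𝓝 θ) := by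
  -- On the image `G` takes values in the bounded box `Θ`, so conditioning makes the estimator
  -- bounded.
  have hb : Bornology.IsBounded (G '' (D.F₀ '' D.Θ)) := by
    rw [hG.image_image]
    exact (Metric.isBounded_Icc D.lo D.hi).subset D.Θ_subset_Icc
  have h1 := hξ.tendsto_setIntegral hθ (F₀_image_mem_nhds hθ) hb
    (Design.contDiffAt_leftInv hG hθ).continuousAt
  have h2 := (ENNReal.tendsto_toReal (by simp)).comp
    (tendsto_inv_iff.2 (hξ.tendsto_measure_mem hθ (F₀_image_mem_nhds hθ)))
  have h := h2.smul h1
  rw [inv_one, ENNReal.toReal_one, one_smul, hG hθ] at h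
  refine h.congr fun x => ?_
  rw [ProbabilityTheory.cond, integral_smul_measure]
  rfl

theorem tendsto_expectation (hξ : IsExperiment D P ξ) (hG : LeftInvOn G D.F₀ D.Θ)
    (hθ : θ ∈ D.Θ) (hb : Bornology.IsBounded (G '' Icc 0 1)) :
    Tendsto (fun x : ℕ × ℝ => ∫ w, G (empFreq ξ x.1 w) ∂(P θ x.2)) (atTop ×ˢ atTop) (𝓝 θ) := by
  have hA : Icc (0 : Fin 4 → ℝ) 1 ∈ 𝓝 (D.F₀ θ) := by
    rw [← pi_univ_Icc]
    exact set_pi_mem_nhds finite_univ fun j _ =>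
      Icc_mem_nhds (Design.F₀_mem_Ioo hθ j).1 (Design.F₀_mem_Ioo hθ j).2
  have h := hξ.tendsto_setIntegral hθ hA hb (Design.contDiffAt_leftInv hG hθ).continuousAt
  rw [hG hθ] at h
  refine h.congr fun x => ?_
  rw [show {w | empFreq ξ x.1 w ∈ Icc 0 1} = univ from
    eq_univ_of_forall fun w => empFreq_mem_Icc ξ x.1 w, Measure.restrict_univ]

theorem hasStrictFDerivAt_leftInv (hG : LeftInvOn G D.F₀ D.Θ) (hθ : θ ∈ D.Θ) :
    HasStrictFDerivAt G (fderiv ℝ G (D.F₀ θ)) (D.F₀ θ) :=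
  (Design.contDiffAt_leftInv hG hθ).hasStrictFDerivAt (by simp)

theorem fderiv_smul_eq_mulVec (z : Fin 4 → ℝ) :
    fderiv ℝ G (D.F₀ θ) (fun j => stdDev D θ j * z j)
      = (jac G (D.F₀ θ) * Matrix.diagonal (stdDev D θ)) *ᵥ z := by
  rw [← Matrix.mulVec_mulVec, jac_mulVec]
  congr 1
  ext j
  rw [Matrix.mulVec_diagonal]

theorem tendsto_sqrt_smul_sub (hG : LeftInvOn G D.F₀ D.Θ) (hθ : θ ∈ D.Θ)
    (z : EuclideanSpace ℝ (Fin 4)) :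
    Tendsto (fun p : (ℕ × ℝ) × EuclideanSpace ℝ (Fin 4) => Real.sqrt p.1.1 •
        (G (freqOf (stdDev D θ) (D.F p.1.2 θ) p.1.1 p.2) - G (D.F p.1.2 θ)))
      ((atTop ×ˢ atTop) ×ˢ 𝓝 z)
      (𝓝 ((jac G (D.F₀ θ) * Matrix.diagonal (stdDev D θ)) *ᵥ z.ofLp)) := by
  rw [← fderiv_smul_eq_mulVec]
  exact tendsto_sqrt_smul_comp_freqOf_sub (n := fun x : ℕ × ℝ => x.1) tendsto_fst
    (tendsto_F_snd hθ) (hasStrictFDerivAt_leftInv hG hθ) z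

theorem tendstoInDistribution_estimator (hξ : IsExperiment D P ξ) (hG : LeftInvOn G D.F₀ D.Θ)
    (hθ : θ ∈ D.Θ) :
    TendstoInDistribution
      (fun (x : ℕ × ℝ) (w : Ω) => WithLp.toLp 2
        (Real.sqrt x.1 • (G (empFreq ξ x.1 w) - G (D.F x.2 θ))))
      (atTop ×ˢ atTop) id (fun x => P θ x.2)
      (multivariateGaussian 0 (deltaCov G (D.F₀ θ))) := by
  set B := jac G (D.F₀ θ) * Matrix.diagonal (stdDev D θ) with hB
  have hcont : Continuous fun z : EuclideanSpace ℝ (Fin 4) =>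
      (WithLp.toLp 2 (B *ᵥ z.ofLp) : EuclideanSpace ℝ (Fin 4)) :=
    (PiLp.continuous_toLp 2 _).comp (continuous_const.matrix_mulVec (PiLp.continuous_ofLp 2 _))
  have h := (hξ.tendsto_stdFreq hθ).comp_of_tendsto
    (g := fun x z => (WithLp.toLp 2 (Real.sqrt x.1 •
      (G (freqOf (stdDev D θ) (D.F x.2 θ) x.1 z) - G (D.F x.2 θ))) : EuclideanSpace ℝ (Fin 4)))
    hcont
    (fun z => ((PiLp.continuous_toLp 2 _).tendsto _).comp (tendsto_sqrt_smul_sub hG hθ z))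
    (fun x => by
      simp_rw [freqOf_stdFreq ξ (stdDev_ne_zero hθ)]
      exact (measurable_comp_empFreq hξ.measurable x.1 fun p => (WithLp.toLp 2
        (Real.sqrt x.1 • (G p - G (D.F x.2 θ))) : EuclideanSpace ℝ (Fin 4))).aemeasurable)
  simp_rw [freqOf_stdFreq ξ (stdDev_ne_zero hθ)] at h
  refine h.of_map_eq aemeasurable_id ?_
  rw [Measure.map_id, map_mulVec_stdGaussian, deltaCov_eq_mul_transpose G (stdDev_sq hθ)]

theorem tendsto_measure_mem_ellipsoid (hξ : IsExperiment D P ξ) (hG : LeftInvOn G D.F₀ D.Θ)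
    {α : ℝ} (hα : α ∈ Ioo (0 : ℝ) 1) (hθ : θ ∈ D.Θ) :
    Tendsto (fun x : ℕ × ℝ => P θ x.2 {w | G (D.F x.2 θ) ∈
        {G (empFreq ξ x.1 w)} + (1 / Real.sqrt x.1) • ellipsoid G α (empFreq ξ x.1 w)})
      (atTop ×ˢ atTop) (𝓝 (ENNReal.ofReal (1 - α))) := by
  have hBu : IsUnit (jac G (D.F₀ θ) * Matrix.diagonal (stdDev D θ)) :=
    isUnit_jac_mul_diagonal (Design.isUnit_jac_leftInv hG hθ) (stdDev_ne_zero hθ)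
  have hcov := deltaCov_eq_mul_transpose G (stdDev_sq hθ)
  set B := jac G (D.F₀ θ) * Matrix.diagonal (stdDev D θ) with hB
  have hcovu : IsUnit (deltaCov G (D.F₀ θ)) := by
    rw [hcov]
    refine hBu.mul ?_
    rw [Matrix.isUnit_iff_isUnit_det, Matrix.det_transpose]
    exact (Matrix.isUnit_iff_isUnit_det B).1 hBu
  have hinv := continuousAt_inv_deltaCov (Design.contDiffAt_leftInv hG hθ) hcovu
  let quad : (Fin 4 → ℝ) × Matrix (Fin 4) (Fin 4) ℝ → ℝ := fun y => y.1 ⬝ᵥ (y.2 *ᵥ y.1)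
  have hquad : Continuous quad :=
    continuous_fst.dotProduct (continuous_snd.matrix_mulVec continuous_fst)
  have h := (hξ.tendsto_stdFreq hθ).comp_of_tendsto
    (g := fun x z => quad (Real.sqrt x.1 •
      (G (freqOf (stdDev D θ) (D.F x.2 θ) x.1 z) - G (D.F x.2 θ)),
      (deltaCov G (freqOf (stdDev D θ) (D.F x.2 θ) x.1 z))⁻¹))
    (g₀ := fun z => ∑ i, z i ^ 2) (by fun_prop)
    (fun z => by
      have hlim := (hquad.tendsto _).comp ((tendsto_sqrt_smul_sub hG hθ z).prodMk_nhds
        (hinv.tendsto.comp (tendsto_freqOf (S := stdDev D θ) (n := fun x : ℕ × ℝ => x.1)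
          tendsto_fst (tendsto_F_snd hθ) z)))
      refine hlim.trans_eq (congrArg 𝓝 ?_)
      simp only [quad]
      rw [hcov, mulVec_dotProduct_inv_mul_transpose hBu]
      simp [dotProduct, sq])
    (fun x => by
      simp_rw [freqOf_stdFreq ξ (stdDev_ne_zero hθ)]
      exact (measurable_comp_empFreq hξ.measurable x.1 fun p => quad (Real.sqrt x.1 •
        (G p - G (D.F x.2 θ)), (deltaCov G p)⁻¹)).aemeasurable)
  simp_rw [freqOf_stdFreq ξ (stdDev_ne_zero hθ)] at h
  -- The portmanteau theorem applies to the half-line because its boundary point carries no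
  -- chi-square mass.
  have hport := ProbabilityMeasure.tendsto_measure_of_null_frontier_of_tendsto' h.tendsto
    (E := Iic (chiSquareQuantile 4 (1 - α))) (by
      simp only [ProbabilityMeasure.coe_mk]
      rw [← chiSquare_eq_map_stdGaussian, frontier_Iic]
      exact measure_singleton _)
  simp only [ProbabilityMeasure.coe_mk] at hport
  rw [← chiSquare_eq_map_stdGaussian,
    chiSquare_Iic_chiSquareQuantile 3 ⟨sub_pos.2 hα.2, sub_lt_self 1 hα.1⟩] at hport
  refine hport.congr' ?_
  filter_upwards [tendsto_fst.eventually (eventually_gt_atTop 0)] with x hx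
  rw [Measure.map_apply_of_aemeasurable (h.forall_aemeasurable x) measurableSet_Iic]
  congr 1
  ext w
  rw [mem_ofPred_eq, mem_singleton_add_smul_ellipsoid_iff (Real.sqrt_pos.2 (Nat.cast_pos.2 hx))]
  rfl

theorem le_liminf_measure_mem_confRegion (hξ : IsExperiment D P ξ) (hG : LeftInvOn G D.F₀ D.Θ)
    {α : ℝ} (hα : α ∈ Ioo (0 : ℝ) 1) (hθ : θ ∈ D.Θ) :
    ENNReal.ofReal (1 - α) ≤ liminf (fun x : ℕ × ℝ => P θ x.2 {w | θ ∈
      D.confRegion G α x.1 x.2 (Design.biasRemainder x.2) (empFreq ξ x.1 w)})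
      (atTop ×ˢ atTop) := by
  rw [← (hξ.tendsto_measure_mem_ellipsoid hG hα hθ).liminf_eq]
  refine liminf_le_liminf ?_
  filter_upwards [tendsto_snd.eventually (Design.bias_mem hG hθ)] with x hx
  refine measure_mono fun w hw => ?_
  have hw' : G (D.F x.2 θ) ∈ {G (empFreq ξ x.1 w)}
      + (1 / Real.sqrt x.1) • ellipsoid G α (empFreq ξ x.1 w) := hw
  -- Decomposition `θ = μ + (θ - μ)`: the ellipsoid covers the first term, the bias box with its
  -- ball the second.
  have h := Set.add_mem_add hw' hx
  rw [← add_assoc, add_sub_cancel] at h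
  exact h

end IsExperiment

theorem Design.biasRemainder_isLittleO_add :
    (fun x : ℕ × ℝ => biasRemainder x.2) =o[atTop ×ˢ atTop]
      fun x : ℕ × ℝ => 1 / Real.sqrt x.1 + 1 / x.2 := by
  refine (biasRemainder_isLittleO.comp_tendsto
    (tendsto_snd (f := (atTop : Filter ℕ)))).trans_isBigO (IsBigO.of_bound 1 ?_)
  filter_upwards [tendsto_snd.eventually (eventually_gt_atTop (0 : ℝ))] with x hx
  have h1 : 0 ≤ 1 / Real.sqrt x.1 := one_div_nonneg.2 (Real.sqrt_nonneg _)
  have h2 : 0 < 1 / x.2 := one_div_pos.2 hx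
  rw [Function.comp_apply, Real.norm_of_nonneg h2.le, Real.norm_of_nonneg (by positivity)]
  linarith

end OpenQubit

/-- `G` is `F_0⁻¹` on `F_0(Θ)`, extended arbitrarily outside; the estimator is
`θ̂ = G (empFreq ξ n)`.  The limit `(n, u_max) → (∞, ∞)` is taken along
`atTop ×ˢ atTop`. -/
theorem mainTheorem1 (D : OpenQubit.Design) {Ω : Type*} [MeasurableSpace Ω]
    (P : (Fin 4 → ℝ) → ℝ → Measure Ω) [∀ θ u, IsProbabilityMeasure (P θ u)]
    (ξ : Fin 4 → ℕ → Ω → Bool) (hξ : OpenQubit.IsExperiment D P ξ) :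
    -- `F_0` is injective on `Θ` with open image contained in `(0,1)⁴`
    (InjOn D.F₀ D.Θ ∧ IsOpen (D.F₀ '' D.Θ) ∧ ContDiffOn ℝ ∞ D.F₀ D.Θ ∧
      D.F₀ '' D.Θ ⊆ Set.univ.pi fun _ => Ioo 0 1) ∧
    -- the suprema defining the box `Δ` are finite
    (∀ i, BddAbove (D.biasValues i)) ∧
    ∀ G : (Fin 4 → ℝ) → (Fin 4 → ℝ), LeftInvOn G D.F₀ D.Θ →
      -- with `InjOn` etc.: `F_0` is a diffeomorphism of `Θ` onto its image
      ContDiffOn ℝ ∞ G (D.F₀ '' D.Θ) ∧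
      -- asymptotic unbiasedness
      (∀ θ ∈ D.Θ,
        Tendsto (fun x : ℕ × ℝ =>
            P θ x.2 {w | OpenQubit.empFreq ξ x.1 w ∈ D.F₀ '' D.Θ})
          (atTop ×ˢ atTop) (𝓝 1) ∧
        Tendsto (fun x : ℕ × ℝ => ∫ w, G (OpenQubit.empFreq ξ x.1 w)
            ∂((P θ x.2)[|{w | OpenQubit.empFreq ξ x.1 w ∈ D.F₀ '' D.Θ}]))
          (atTop ×ˢ atTop) (𝓝 θ) ∧
        (Bornology.IsBounded (G '' Icc 0 1) →
          Tendsto (fun x : ℕ × ℝ => ∫ w, G (OpenQubit.empFreq ξ x.1 w) ∂(P θ x.2))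
            (atTop ×ˢ atTop) (𝓝 θ))) ∧
      -- `√n (θ̂ - μ) → N(0, Σ)` in law, where `μ = F_0⁻¹(p)` and `p = F_{1/u}(θ)`
      (∀ θ ∈ D.Θ,
        TendstoInDistribution
          (fun (x : ℕ × ℝ) (w : Ω) => WithLp.toLp 2
            (Real.sqrt x.1 • (G (OpenQubit.empFreq ξ x.1 w) - G (D.F x.2 θ))))
          (atTop ×ˢ atTop) id (fun x => P θ x.2)
          (multivariateGaussian 0 (OpenQubit.deltaCov G (D.F₀ θ)))) ∧
      -- the plug-in ellipsoid has asymptotic level `1 - α` for `μ`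
      (∀ α ∈ Ioo (0 : ℝ) 1, ∀ θ ∈ D.Θ,
        Tendsto (fun x : ℕ × ℝ => P θ x.2 {w | G (D.F x.2 θ) ∈
            {G (OpenQubit.empFreq ξ x.1 w)} + (1 / Real.sqrt x.1) •
              OpenQubit.ellipsoid G α (OpenQubit.empFreq ξ x.1 w)})
          (atTop ×ˢ atTop) (𝓝 (ENNReal.ofReal (1 - α)))) ∧
      -- the bias `θ - μ` lies in `u⁻¹ Δ + o(u⁻¹)`
      (∃ ρ : ℝ → ℝ, ρ =o[atTop] (fun u => 1 / u) ∧
        ∀ θ ∈ D.Θ, ∀ᶠ u in atTop,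
          θ - G (D.F u θ) ∈ (1 / u) • D.Δ + Metric.closedBall 0 (ρ u)) ∧
      -- the confidence region for `θ`
      (∃ r : ℕ → ℝ → ℝ,
        (fun x : ℕ × ℝ => r x.1 x.2) =o[atTop ×ˢ atTop]
          (fun x : ℕ × ℝ => 1 / Real.sqrt x.1 + 1 / x.2) ∧
        ∀ α ∈ Ioo (0 : ℝ) 1, ∀ θ ∈ D.Θ,
          ENNReal.ofReal (1 - α) ≤
            liminf (fun x : ℕ × ℝ => P θ x.2 {w | θ ∈
              D.confRegion G α x.1 x.2 (r x.1 x.2) (OpenQubit.empFreq ξ x.1 w)})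
              (atTop ×ˢ atTop)) := by
  refine ⟨⟨D.injOn_F₀, D.isOpen_F₀_image, D.contDiff_F₀.contDiffOn, ?_⟩, D.bddAbove_biasValues,
    fun G hG => ⟨?_, fun θ hθ => ⟨?_, ?_, ?_⟩, fun θ hθ => ?_, fun α hα θ hθ => ?_, ?_, ?_⟩⟩
  · rintro _ ⟨θ, hθ, rfl⟩ i _
    exact OpenQubit.Design.F₀_mem_Ioo hθ i
  · rintro _ ⟨θ, hθ, rfl⟩
    exact (OpenQubit.Design.contDiffAt_leftInv hG hθ).contDiffWithinAt
  · exact hξ.tendsto_measure_mem hθ (OpenQubit.IsExperiment.F₀_image_mem_nhds hθ)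
  · exact hξ.tendsto_condExpectation hG hθ
  · exact hξ.tendsto_expectation hG hθ
  · exact hξ.tendstoInDistribution_estimator hG hθ
  · exact hξ.tendsto_measure_mem_ellipsoid hG hα hθ
  · exact ⟨OpenQubit.Design.biasRemainder, OpenQubit.Design.biasRemainder_isLittleO,
      fun θ hθ => OpenQubit.Design.bias_mem hG hθ⟩
  · exact ⟨fun _ u => OpenQubit.Design.biasRemainder u,
      OpenQubit.Design.biasRemainder_isLittleO_add,
      fun α hα θ hθ => hξ.le_liminf_measure_mem_confRegion hG hα hθ⟩
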